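/- All Hilbert spaces are finite-dimensional, logarithms are to base 2, $S$ is the von Neumann entropy, $I(A;B)=S(A)+S(B)-S(AB)$ and $I(A;B|C)=S(AC)+S(BC)-S(C)-S(ABC)$. **Setting.** A q-c source coding setup consists of a pure state $\Psi_{RAB}$ on $\mathcal H_R\otimes\mathcal H_A\otimes\mathcal H_B$ (a purification of the source $\rho_{AB}=\mathrm{Tr}_R\Psi_{RAB}$), a reconstruction space $\mathcal H_{\hat X}$, and a distortion observable $\Delta\ge 0$ on $\mathcal H_R\otimes\mathcal H_{\hat X}$. An $(n,\Theta_1,\Theta_2)$ q-c protocol consists of POVMs $\{\Lambda^A_i\}_{i=1}^{\Theta_1}$ on $\mathcal H_A^{\otimes n}$ and $\{\Lambda^B_j\}_{j=1}^{\Theta_2}$ on $\mathcal H_B^{\otimes n}$ and states $S_{i,j}$ on $\mathcal H_{\hat X}^{\otimes n}$; it acts as $\mathcal N(\omega)=\sum_{i,j}\mathrm{Tr}\{(\Lambda^A_i\otimes\Lambda^B_j)\omega\}S_{i,j}$, and its distortion is $\bar d=\mathrm{Tr}\{\Delta^{(n)}(\mathrm{id}\otimes\mathcal N)(\Psi_{RAB}^{\otimes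 n})\}$ with $\Delta^{(n)}=\frac1n\sum_{t=1}^n\Delta_{R_t\hat X_t}\otimes I^{\otimes[n]\setminus t}$. A triplet $(R_1,R_2,D)$ of reals is achievable if for every $\epsilon>0$ and all sufficiently large $n$ there is an $(n,\Theta_1,\Theta_2)$ protocol with $\frac1n\log_2\Theta_i\le R_i+\epsilon$ ($i=1,2$) and $\bar d\le D+\epsilon$. For a quantum channel (completely positive trace-preserving map) $\mathcal N_{AB\to W_1W_2Q\hat X}$ put $\sigma^{RW_1W_2Q\hat X}=(\mathrm{id}_R\otimes\mathcal N)(\Psi_{RAB})$, and say that $\mathcal N$ is *admissible* for $(R_1,R_2,D)$ if $I(R;Q)_\sigma=0$ and $$R_1\ge I(W_1;R|W_2,Q)_\sigma,\quad R_2\ge I(W_2;R|W_1,Q)_\sigma,\quad R_1+R_2\ge I(W_1,W_2;R|Q)_\sigma,\quad D\ge\mathrm{Tr}\{\Delta\,\sigma^{R\hat X}\}.$$ **Theorem (outer bound).** Let $(R_1,R_2,D)$ be achievable for a q-c source coding setup. Then: (a) There are auxiliary spaces $\mathcal H_{W_1},\mathcal H_{W_2},\mathcal H_Q$ and a quantum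 test channel $\mathcal N_{AB\to W_1W_2Q\hat X}$ that is admissible for $(R_1,R_2,D)$. (b) For every $\epsilon>0$ there are $n\ge1$, finite alphabets for classical registers $W_1,W_2$, and, with $\mathcal H_Q$ the truncated Fock space $\bigoplus_{j=1}^{n}\mathcal H_R^{\otimes(j-1)}$, a quantum channel of the form $$\mathcal N(\omega_{AB})=\bigoplus_{j=1}^n\frac1n\sum_{w_1,w_2}|w_1,w_2\rangle\langle w_1,w_2|\otimes\mathrm{Tr}_{AA'BB'}\big\{(\Lambda^{A,j}_{w_1}\otimes\Lambda^{B,j}_{w_2}\otimes I)(\omega_{AB}\otimes E_j)\big\}\otimes S^j_{w_1,w_2}$$ that is admissible for $(R_1+\epsilon,R_2+\epsilon,D+\epsilon)$. Here $\mathcal H_{A'}=\mathcal H_A^{\otimes(n-1)}$ and $\mathcal H_{B'}=\mathcal H_B^{\otimes(n-1)}$, each $E_j$ is a state on $\mathcal H_{A'}\otimes\mathcal H_{B'}\otimes\mathcal H_R^{\otimes(j-1)}$, $\{\Lambda^{A,j}_{w_1}\}_{w_1}$ and $\{\Lambda^{B,j}_{w_2}\}_{w_2}$ are POVMs on $\mathcal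 H_A\otimes\mathcal H_{A'}$ and $\mathcal H_B\otimes\mathcal H_{B'}$, and each $S^j_{w_1,w_2}$ is a state on $\mathcal H_{\hat X}$. -/

import Mathlib

open scoped ComplexOrder Kronecker

/-! Finite-dimensional Hilbert spaces are `ℂ^ι` for a finite index type `ι`; operators are matrices,
tensor products are product index types, `n`-fold tensor powers are index types `Fin n → ι`,
and direct sums are sigma types. All logarithms are to base 2. -/

namespace QCRD

/-- Density operators. -/
def IsDensity {ι : Type*} [Fintype ι] (ρ : Matrix ι ι ℂ) : Prop :=
  ρ.PosSemidef ∧ ρ.trace = 1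

/-- `Λ` is a positive-operator valued measure with outcome set `κ`. -/
def IsPOVM {κ ι : Type*} [Fintype κ] [Fintype ι] [DecidableEq ι]
    (Λ : κ → Matrix ι ι ℂ) : Prop :=
  (∀ x, (Λ x).PosSemidef) ∧ ∑ x, Λ x = 1

/-- Partial trace over the second factor. -/
def trRight {α β : Type*} [Fintype β] (M : Matrix (α × β) (α × β) ℂ) : Matrix α α ℂ :=
  Matrix.of fun i i' => ∑ k, M (i, k) (i', k)

/-- Partial trace over the first factor. -/
def trLeft {α β : Type*} [Fintype α] (M : Matrix (α × β) (α × β) ℂ) : Matrix β β ℂ :=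
  Matrix.of fun j j' => ∑ k, M (k, j) (k, j')

/-- Partial trace over the middle factor. -/
def trMid {α β γ : Type*} [Fintype β] (M : Matrix (α × β × γ) (α × β × γ) ℂ) :
    Matrix (α × γ) (α × γ) ℂ :=
  Matrix.of fun i i' => ∑ k, M (i.1, k, i.2) (i'.1, k, i'.2)

open Classical in
/-- Von Neumann entropy `-Tr ρ log₂ ρ` of a Hermitian matrix (`0` on other matrices). -/
noncomputable def entropy {ι : Type*} [Fintype ι] [DecidableEq ι] (ρ : Matrix ι ι ℂ) : ℝ :=
  if h : ρ.IsHermitian then ∑ i, Real.negMulLog (h.eigenvalues i) / Real.log 2 else 0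

/-- Quantum mutual information `I(A;B) = S(A) + S(B) - S(AB)`. -/
noncomputable def mutualInfo {α β : Type*} [Fintype α] [Fintype β] [DecidableEq α] [DecidableEq β]
    (ρ : Matrix (α × β) (α × β) ℂ) : ℝ :=
  entropy (trRight ρ) + entropy (trLeft ρ) - entropy ρ

/-- Conditional quantum mutual information `I(A;B|C) = S(AC) + S(BC) - S(C) - S(ABC)`
of a state on `A ⊗ B ⊗ C`. -/
noncomputable def condMutualInfo {α β γ : Type*} [Fintype α] [Fintype β] [Fintype γ]
    [DecidableEq α] [DecidableEq β] [DecidableEq γ]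
    (ρ : Matrix (α × β × γ) (α × β × γ) ℂ) : ℝ :=
  entropy (trMid ρ) + entropy (trLeft ρ) - entropy (trLeft (trLeft ρ)) - entropy ρ

/-- `id_κ ⊗ N` for a (linear) map `N` on matrices. -/
def ampl (κ : Type*) {α β : Type*} (N : Matrix α α ℂ → Matrix β β ℂ)
    (M : Matrix (κ × α) (κ × α) ℂ) : Matrix (κ × β) (κ × β) ℂ :=
  Matrix.of fun i i' => N (Matrix.of fun s s' => M (i.1, s) (i'.1, s')) i.2 i'.2

/-- Quantum channels: completely positive trace-preserving linear maps. -/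
def IsChannel {α β : Type*} [Fintype α] [Fintype β]
    (N : Matrix α α ℂ →ₗ[ℂ] Matrix β β ℂ) : Prop :=
  (∀ (k : ℕ) (M : Matrix (Fin k × α) (Fin k × α) ℂ), M.PosSemidef →
    (ampl (Fin k) N M).PosSemidef) ∧
  ∀ M, (N M).trace = M.trace

/-- A q-c source coding setup: a unit vector `ψ` in `R ⊗ A ⊗ B` (a purification of the source
`ρ_AB = Tr_R |ψ⟩⟨ψ|`), a reconstruction space `X` and a distortion observable `Δ ≥ 0` on `R ⊗ X`. -/
structure Setup (r a b x : Type*) [Fintype r] [Fintype a] [Fintype b] [Fintype x] where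
  ψ : r × a × b → ℂ
  ψ_norm : ∑ i, ‖ψ i‖ ^ 2 = 1
  Δ : Matrix (r × x) (r × x) ℂ
  Δ_pos : Δ.PosSemidef

/-- An `(n, Θ₁, Θ₂)` q-c protocol: POVMs on `A^n` and `B^n` with `Θ₁` and `Θ₂` outcomes, and
reconstruction states on `X^n`. -/
structure Protocol (a b x : Type*) [Fintype a] [Fintype b] [Fintype x]
    [DecidableEq a] [DecidableEq b] (n Θ₁ Θ₂ : ℕ) where
  ΛA : Fin Θ₁ → Matrix (Fin n → a) (Fin n → a) ℂ
  ΛB : Fin Θ₂ → Matrix (Fin n → b) (Fin n → b) ℂ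
  S : Fin Θ₁ → Fin Θ₂ → Matrix (Fin n → x) (Fin n → x) ℂ
  povmA : IsPOVM ΛA
  povmB : IsPOVM ΛB
  densityS : ∀ i j, IsDensity (S i j)

section

variable {r a b x : Type*} [Fintype r] [Fintype a] [Fintype b] [Fintype x]
  [DecidableEq r] [DecidableEq a] [DecidableEq b] [DecidableEq x]

/-- The pure state `|ψ⟩⟨ψ|` on `R ⊗ A ⊗ B`. -/
def Setup.Ψ (s : Setup r a b x) : Matrix (r × a × b) (r × a × b) ℂ :=
  Matrix.vecMulVec s.ψ (star s.ψ)

/-- The `n`-fold tensor power `|ψ⟩⟨ψ|^{⊗n}`, regrouped as a state on `R^n ⊗ A^n ⊗ B^n`. -/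
def Setup.Ψpow (s : Setup r a b x) (n : ℕ) :
    Matrix ((Fin n → r) × (Fin n → a) × (Fin n → b))
      ((Fin n → r) × (Fin n → a) × (Fin n → b)) ℂ :=
  Matrix.of fun i i' =>
    ∏ t, s.Ψ (i.1 t, i.2.1 t, i.2.2 t) (i'.1 t, i'.2.1 t, i'.2.2 t)

/-- Symbol-wise average distortion observable `(1/n) ∑ₜ Δ_{RₜXₜ} ⊗ I` on `R^n ⊗ X^n`. -/
noncomputable def Setup.Δavg (s : Setup r a b x) (n : ℕ) :
    Matrix ((Fin n → r) × (Fin n → x)) ((Fin n → r) × (Fin n → x)) ℂ :=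
  Matrix.of fun i i' => (1 / (n : ℂ)) * ∑ t, s.Δ (i.1 t, i.2 t) (i'.1 t, i'.2 t) *
    ∏ t' ∈ Finset.univ.erase t,
      (1 : Matrix (r × x) (r × x) ℂ) (i.1 t', i.2 t') (i'.1 t', i'.2 t')

/-- The overall action `ω ↦ ∑ᵢⱼ Tr{(Λᴬᵢ ⊗ Λᴮⱼ) ω} Sᵢⱼ` of a protocol. -/
noncomputable def Protocol.action {n Θ₁ Θ₂ : ℕ} (P : Protocol a b x n Θ₁ Θ₂)
    (ω : Matrix ((Fin n → a) × (Fin n → b)) ((Fin n → a) × (Fin n → b)) ℂ) :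
    Matrix (Fin n → x) (Fin n → x) ℂ :=
  ∑ i, ∑ j, ((P.ΛA i ⊗ₖ P.ΛB j) * ω).trace • P.S i j

/-- Average distortion of an `n`-letter protocol. -/
noncomputable def Setup.distortion (s : Setup r a b x) {n Θ₁ Θ₂ : ℕ}
    (P : Protocol a b x n Θ₁ Θ₂) : ℝ :=
  (s.Δavg n * ampl (Fin n → r) P.action (s.Ψpow n)).trace.re

/-- Achievable rate–distortion triplets. -/
def Setup.Achievable (s : Setup r a b x) (R₁ R₂ D : ℝ) : Prop :=
  ∀ ε > 0, ∀ᶠ n : ℕ in Filter.atTop, ∃ (Θ₁ Θ₂ : ℕ) (P : Protocol a b x n Θ₁ Θ₂),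
    1 / (n : ℝ) * Real.logb 2 Θ₁ ≤ R₁ + ε ∧
    1 / (n : ℝ) * Real.logb 2 Θ₂ ≤ R₂ + ε ∧
    s.distortion P ≤ D + ε

/-- The single-letter outer-bound conditions for a test channel `N : AB → W₁ W₂ Q X`, evaluated at
`σ = (id_R ⊗ N)(|ψ⟩⟨ψ|)`, a state on `R ⊗ W₁ ⊗ W₂ ⊗ Q ⊗ X`. -/
def Setup.OuterBound (s : Setup r a b x) {w₁ w₂ q : Type*} [Fintype w₁] [Fintype w₂] [Fintype q]
    [DecidableEq w₁] [DecidableEq w₂] [DecidableEq q]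
    (N : Matrix (a × b) (a × b) ℂ →ₗ[ℂ] Matrix (w₁ × w₂ × q × x) (w₁ × w₂ × q × x) ℂ)
    (R₁ R₂ D : ℝ) : Prop :=
  let σ : Matrix (r × w₁ × w₂ × q × x) (r × w₁ × w₂ × q × x) ℂ := ampl r N s.Ψ
  -- marginals on `W₁ R (W₂ Q)`, `W₂ R (W₁ Q)`, `(W₁ W₂) R Q`, `R Q` and `R X`
  let σ₁ : Matrix (w₁ × r × w₂ × q) (w₁ × r × w₂ × q) ℂ := Matrix.of fun i i' =>
    ∑ k, σ (i.2.1, i.1, i.2.2.1, i.2.2.2, k) (i'.2.1, i'.1, i'.2.2.1, i'.2.2.2, k)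
  let σ₂ : Matrix (w₂ × r × w₁ × q) (w₂ × r × w₁ × q) ℂ := Matrix.of fun i i' =>
    ∑ k, σ (i.2.1, i.2.2.1, i.1, i.2.2.2, k) (i'.2.1, i'.2.2.1, i'.1, i'.2.2.2, k)
  let σ₁₂ : Matrix ((w₁ × w₂) × r × q) ((w₁ × w₂) × r × q) ℂ := Matrix.of fun i i' =>
    ∑ k, σ (i.2.1, i.1.1, i.1.2, i.2.2, k) (i'.2.1, i'.1.1, i'.1.2, i'.2.2, k)
  let σRX : Matrix (r × x) (r × x) ℂ := Matrix.of fun i i' =>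
    ∑ u, ∑ v, ∑ k, σ (i.1, u, v, k, i.2) (i'.1, u, v, k, i'.2)
  IsChannel N ∧
  mutualInfo (trLeft σ₁₂) = 0 ∧
  condMutualInfo σ₁ ≤ R₁ ∧
  condMutualInfo σ₂ ≤ R₂ ∧
  condMutualInfo σ₁₂ ≤ R₁ + R₂ ∧
  (s.Δ * σRX).trace.re ≤ D

end

/-- The truncated Fock space `⊕_{j < n} R^{⊗j}`. -/
abbrev Fock (r : Type*) (n : ℕ) : Type _ := Σ j : Fin n, (Fin (j : ℕ) → r)

/-- `Tr_{A A' B B'} {(Λ ⊗ Λ' ⊗ I_K)(ω_{AB} ⊗ E_{A'B'K})}`, an operator on `K`. -/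
def measured {a b a' b' κ : Type*} [Fintype a] [Fintype b] [Fintype a'] [Fintype b']
    (Λ : Matrix (a × a') (a × a') ℂ) (Λ' : Matrix (b × b') (b × b') ℂ)
    (ω : Matrix (a × b) (a × b) ℂ) (E : Matrix (a' × b' × κ) (a' × b' × κ) ℂ) : Matrix κ κ ℂ :=
  Matrix.of fun k k' => ∑ s, ∑ s', ∑ t, ∑ t',
    Λ s' s * Λ' t' t * ω (s.1, t.1) (s'.1, t'.1) * E (s.2, t.2, k) (s'.2, t'.2, k')

/-- Distributed test channels `AB → W₁ W₂ Q X` with `Q = ⊕_{j < n} R^{⊗j}`, `n = m + 1`: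
`N(ω) = ⊕ⱼ (1/n) ∑_{u,v} |u,v⟩⟨u,v| ⊗ Tr_{AA'BB'}{(Λᴬ_{j,u} ⊗ Λᴮ_{j,v} ⊗ I)(ω ⊗ Eⱼ)} ⊗ S_{j,u,v}`.
Given a uniformly distributed `j`, a state `Eⱼ` on `A' ⊗ B' ⊗ R^{⊗j}`, with `A' = A^{⊗m}` and
`B' = B^{⊗m}`, is prepared independently of the input; `W₁` and `W₂` are the classical outcomes of
local measurements of `AA'` and `BB'`; and `X` is prepared from `(j, W₁, W₂)`. -/
def IsDistributed {r a b x : Type*} [Fintype r] [Fintype a] [Fintype b] [Fintype x]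
    [DecidableEq r] [DecidableEq a] [DecidableEq b] {m w₁ w₂ : ℕ}
    (N : Matrix (a × b) (a × b) ℂ →ₗ[ℂ]
      Matrix (Fin w₁ × Fin w₂ × Fock r (m + 1) × x) (Fin w₁ × Fin w₂ × Fock r (m + 1) × x) ℂ) :
    Prop :=
  ∃ (E : ∀ j : Fin (m + 1), Matrix ((Fin m → a) × (Fin m → b) × (Fin (j : ℕ) → r))
        ((Fin m → a) × (Fin m → b) × (Fin (j : ℕ) → r)) ℂ)
    (ΛA : Fin (m + 1) → Fin w₁ → Matrix (a × (Fin m → a)) (a × (Fin m → a)) ℂ)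
    (ΛB : Fin (m + 1) → Fin w₂ → Matrix (b × (Fin m → b)) (b × (Fin m → b)) ℂ)
    (S : Fin (m + 1) → Fin w₁ → Fin w₂ → Matrix x x ℂ),
    (∀ j, IsDensity (E j)) ∧ (∀ j, IsPOVM (ΛA j)) ∧ (∀ j, IsPOVM (ΛB j)) ∧
    (∀ j u v, IsDensity (S j u v)) ∧
    ∀ ω, N ω = Matrix.of fun i i' =>
      if i.1 = i'.1 ∧ i.2.1 = i'.2.1 then
        Matrix.blockDiagonal' (fun j : Fin (m + 1) =>
          (1 / ((m : ℂ) + 1) * S j i.1 i.2.1 i.2.2.2 i'.2.2.2) •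
            measured (ΛA j i.1) (ΛB j i.2.1) ω (E j)) i.2.2.1 i'.2.2.1
      else 0

end QCRD

set_option linter.unusedSectionVars false

/-! For (b), take a good protocol with `m + 1` letters and single-letterise it. Draw a site `j`
uniformly, put the input at site `j`, fill the other sites with fresh copies of `ψ`, run the two
measurements, and keep as `Q` the index `j` with the references of the sites before `j`. The shared
state `E_j` is then `partialPow m j`, independent of the input. By `measured_partialPow`, outcomes
`u, v` leave `R` and `Q` in block `j` in the protocol's own unnormalised conditional state of the
first `j + 1` references. Hence `S(RQ) - S(Q)`, averaged over `j`, telescopes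
(`entropy_refBlock_sub`) to `1 / (m + 1)` times the entropy on all `m + 1` references minus that on
none. On zero references a state is just a number, the probability of the outcome. So each
information quantity is at most `1 / (m + 1)` times the Shannon entropy of the outcomes, hence at
most their log-cardinality (`classical_information_le`). The only quantum inequality needed is
`entropy_sum_le`, entropy of a sum at most sum of entropies. Summed over outcomes, the references
are in a product state, so `I(R;Q) = 0`. The distortion is reproduced exactly
(`distortion_testChannel`), since a site marginal does not depend on how many other references were
kept. For (a) no slack is allowed, while the registers in (b) may grow as `ε` shrinks. But the
admissibility conditions do not tie the reconstruction to `W₁`, `W₂`. With one-dimensional registers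
only `0 ≤ R₁`, `0 ≤ R₂` and the distortion bound remain, and the latter is reached by minimising
over the compact set of channels from `AB` to `X`. -/

namespace QCRD

open Matrix

/-! ### Entropy of unnormalised positive matrices. -/

section Entropy

/-- The function `x ↦ -x log₂ x`. -/
noncomputable def eta (x : ℝ) : ℝ := Real.negMulLog x / Real.log 2

@[simp] lemma eta_zero : eta 0 = 0 := by simp [eta]

@[simp] lemma eta_one : eta 1 = 0 := by simp [eta]

lemma eta_mul (x y : ℝ) : eta (x * y) = y * eta x + x * eta y := by
  simp only [eta, Real.negMulLog_mul]; ring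

lemma concaveOn_eta : ConcaveOn ℝ (Set.Ici 0) eta := by
  have h := Real.concaveOn_negMulLog.smul (c := (Real.log 2)⁻¹)
    (inv_nonneg.2 (Real.log_nonneg (by norm_num)))
  have he : eta = fun x => (Real.log 2)⁻¹ • Real.negMulLog x := by
    funext x; simp [eta, div_eq_inv_mul]
  rw [he]; exact h

/-- Jensen for the uniform distribution on `κ`. The weights need not sum to one, because
conditioning on an outcome produces subnormalised distributions. -/
lemma sum_eta_le {κ : Type*} [Fintype κ] {p : κ → ℝ} (hp : ∀ w, 0 ≤ p w) :
    ∑ w, eta (p w) ≤ eta (∑ w, p w) + (∑ w, p w) * Real.logb 2 (Fintype.card κ) := by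
  rcases isEmpty_or_nonempty κ with hκ | hκ
  · simp
  have hc : (0 : ℝ) < Fintype.card κ := by exact_mod_cast Fintype.card_pos
  have h := concaveOn_eta.le_map_sum (t := Finset.univ) (w := fun _ : κ => (Fintype.card κ : ℝ)⁻¹)
    (p := p) (fun _ _ => by positivity) (by simp) (fun w _ => hp w)
  simp only [smul_eq_mul, ← Finset.mul_sum] at h
  rw [eta_mul] at h
  have h3 : eta (Fintype.card κ : ℝ)⁻¹ = (Fintype.card κ : ℝ)⁻¹ * Real.logb 2 (Fintype.card κ) := by
    simp only [eta, Real.negMulLog, Real.log_inv, Real.logb]; ring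
  rw [h3] at h
  have h4 := mul_le_mul_of_nonneg_left h hc.le
  rw [← mul_assoc, mul_inv_cancel₀ hc.ne', one_mul] at h4
  refine h4.trans (le_of_eq ?_)
  field_simp
  ring

variable {ι κ : Type*} [Fintype ι] [DecidableEq ι] [Fintype κ] [DecidableEq κ]

lemma entropy_eq_sum_eta {ρ : Matrix ι ι ℂ} (h : ρ.IsHermitian) :
    entropy ρ = ∑ i, eta (h.eigenvalues i) := by
  simp [entropy, h, eta]

/-- Expresses entropy through the characteristic polynomial alone, so that invariances follow
without comparing choices of eigenvectors. -/
lemma entropy_eq_roots {ρ : Matrix ι ι ℂ} (h : ρ.IsHermitian) :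
    entropy ρ = (ρ.charpoly.roots.map fun z => eta z.re).sum := by
  rw [entropy_eq_sum_eta h, h.roots_charpoly_eq_eigenvalues]
  simp

/-- The two characteristic polynomials differ only by powers of `X`, and the extra zero roots
contribute `eta 0 = 0`. -/
lemma entropy_mul_comm {A : Matrix ι κ ℂ} {B : Matrix κ ι ℂ} (hAB : (A * B).IsHermitian)
    (hBA : (B * A).IsHermitian) : entropy (A * B) = entropy (B * A) := by
  rw [entropy_eq_roots hAB, entropy_eq_roots hBA]
  have h := congrArg Polynomial.roots (Matrix.charpoly_mul_comm' A B)
  rw [Polynomial.roots_mul (mul_ne_zero (pow_ne_zero _ Polynomial.X_ne_zero)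
      (charpoly_monic _).ne_zero), Polynomial.roots_mul (mul_ne_zero
      (pow_ne_zero _ Polynomial.X_ne_zero) (charpoly_monic _).ne_zero)] at h
  replace h := congrArg (fun m : Multiset ℂ => (m.map fun z => eta z.re).sum) h
  simpa [Multiset.map_nsmul, Multiset.sum_nsmul] using h

lemma entropy_diagonal (d : ι → ℝ) : entropy (diagonal fun i => (d i : ℂ)) = ∑ i, eta (d i) := by
  have h : (diagonal fun i => (d i : ℂ)).IsHermitian := by
    ext i j; by_cases hij : i = j
    · subst hij; simp
    · simp [hij, Ne.symm hij]
  rw [entropy_eq_roots h, charpoly_diagonal, Polynomial.roots_prod _ _ (Finset.prod_ne_zero_iff.2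
    fun i _ => Polynomial.X_sub_C_ne_zero _)]
  simp

/-- The tool for computing entropies below: tensor products, multiples and direct sums are
diagonalised by the corresponding combination of unitaries. -/
lemma entropy_of_isometry {V : Matrix ι κ ℂ} (hV : Vᴴ * V = 1) (d : κ → ℝ) :
    entropy (V * diagonal (fun i => (d i : ℂ)) * Vᴴ) = ∑ i, eta (d i) := by
  have h : (diagonal fun i => (d i : ℂ)).IsHermitian := by
    ext i j; by_cases hij : i = j
    · subst hij; simp
    · simp [hij, Ne.symm hij]
  have h2 : Vᴴ * (V * diagonal fun i => (d i : ℂ)) = diagonal fun i => (d i : ℂ) := by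
    rw [← Matrix.mul_assoc, hV, Matrix.one_mul]
  rw [entropy_mul_comm, h2, entropy_diagonal]
  · exact isHermitian_mul_mul_conjTranspose V h
  · rwa [h2]

lemma exists_unitary_diagonal {ρ : Matrix ι ι ℂ} (h : ρ.IsHermitian) :
    ∃ U : Matrix ι ι ℂ, Uᴴ * U = 1 ∧ U * Uᴴ = 1 ∧
      ρ = U * diagonal (fun i => (h.eigenvalues i : ℂ)) * Uᴴ := by
  refine ⟨h.eigenvectorUnitary, ?_, ?_, ?_⟩
  · exact (Matrix.mem_unitaryGroup_iff'.1 h.eigenvectorUnitary.2)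
  · exact (Matrix.mem_unitaryGroup_iff.1 h.eigenvectorUnitary.2)
  · conv_lhs => rw [h.spectral_theorem]
    rfl

lemma entropy_submatrix (ρ : Matrix ι ι ℂ) (hρ : ρ.IsHermitian) (e : κ ≃ ι) :
    entropy (ρ.submatrix e e) = entropy ρ := by
  rw [entropy_eq_roots hρ, entropy_eq_roots (hρ.submatrix e),
    ← Matrix.charpoly_reindex e.symm ρ]
  rfl

lemma entropy_kronecker {ρ : Matrix ι ι ℂ} {τ : Matrix κ κ ℂ} (hρ : ρ.IsHermitian)
    (hτ : τ.IsHermitian) :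
    entropy (ρ ⊗ₖ τ) = τ.trace.re * entropy ρ + ρ.trace.re * entropy τ := by
  obtain ⟨U, hU, -, hρU⟩ := exists_unitary_diagonal hρ
  obtain ⟨V, hV, -, hτV⟩ := exists_unitary_diagonal hτ
  have h1 : ρ ⊗ₖ τ = (U ⊗ₖ V) * diagonal (fun i : ι × κ =>
      ((hρ.eigenvalues i.1 * hτ.eigenvalues i.2 : ℝ) : ℂ)) * (U ⊗ₖ V)ᴴ := by
    conv_lhs => rw [hρU, hτV]
    rw [Matrix.conjTranspose_kronecker, Matrix.mul_kronecker_mul, Matrix.mul_kronecker_mul,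
      Matrix.diagonal_kronecker_diagonal]
    simp
  rw [h1, entropy_of_isometry]
  · rw [entropy_eq_sum_eta hρ, entropy_eq_sum_eta hτ, hρ.trace_eq_sum_eigenvalues,
      hτ.trace_eq_sum_eigenvalues, Fintype.sum_prod_type]
    simp only [eta_mul, Finset.sum_add_distrib, ← Finset.mul_sum, ← Finset.sum_mul]
    simp
  · rw [Matrix.conjTranspose_kronecker, ← Matrix.mul_kronecker_mul, hU, hV,
      Matrix.one_kronecker_one]

lemma entropy_smul {ρ : Matrix ι ι ℂ} (hρ : ρ.IsHermitian) (c : ℝ) :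
    entropy ((c : ℂ) • ρ) = c * entropy ρ + ρ.trace.re * eta c := by
  obtain ⟨U, hU, -, hρU⟩ := exists_unitary_diagonal hρ
  have h1 : (c : ℂ) • ρ = U * diagonal (fun i => ((c * hρ.eigenvalues i : ℝ) : ℂ)) * Uᴴ := by
    conv_lhs => rw [hρU]
    rw [← Matrix.smul_mul, ← Matrix.mul_smul, ← Matrix.diagonal_smul]
    congr 3; ext i; simp
  rw [h1, entropy_of_isometry hU, entropy_eq_sum_eta hρ, hρ.trace_eq_sum_eigenvalues]
  simp only [eta_mul, Finset.sum_add_distrib, ← Finset.mul_sum, ← Finset.sum_mul]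
  simp [add_comm]

/-- Applied to the zeroth tensor power of `R`, where an unnormalised state is a probability `p` and
its entropy is the classical term `eta p`. -/
lemma entropy_unique [Unique ι] {ρ : Matrix ι ι ℂ} (hρ : ρ.IsHermitian) :
    entropy ρ = eta ρ.trace.re := by
  rw [entropy_eq_sum_eta hρ, hρ.trace_eq_sum_eigenvalues]
  simp

lemma entropy_blockDiagonal' {β : ι → Type*} [∀ i, Fintype (β i)] [∀ i, DecidableEq (β i)]
    {ρ : ∀ i, Matrix (β i) (β i) ℂ} (hρ : ∀ i, (ρ i).IsHermitian) :
    entropy (blockDiagonal' ρ) = ∑ i, entropy (ρ i) := by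
  choose U hU _ hρU using fun i => exists_unitary_diagonal (hρ i)
  have h1 : blockDiagonal' ρ = blockDiagonal' U *
      diagonal (fun i : Σ i, β i => (((hρ i.1).eigenvalues i.2 : ℝ) : ℂ)) *
        (blockDiagonal' U)ᴴ := by
    rw [blockDiagonal'_conjTranspose, ← blockDiagonal'_diagonal
      (fun i k => (((hρ i).eigenvalues k : ℝ) : ℂ)), ← blockDiagonal'_mul, ← blockDiagonal'_mul]
    congr 1; funext i; exact hρU i
  rw [h1, entropy_of_isometry, Fintype.sum_sigma]
  · exact Finset.sum_congr rfl fun i _ => (entropy_eq_sum_eta (hρ i)).symm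
  · rw [blockDiagonal'_conjTranspose, ← blockDiagonal'_mul]
    simp only [hU]
    exact blockDiagonal'_one

lemma entropy_of_submatrix_eq_blockDiagonal' {β : ι → Type*} [∀ i, Fintype (β i)]
    [∀ i, DecidableEq (β i)] {ρ : ∀ i, Matrix (β i) (β i) ℂ} (hρ : ∀ i, (ρ i).IsHermitian)
    {M : Matrix κ κ ℂ} (e : (Σ i, β i) ≃ κ) (h : M.submatrix e e = blockDiagonal' ρ) :
    entropy M = ∑ i, entropy (ρ i) := by
  have hB : (blockDiagonal' ρ).IsHermitian := by
    rw [Matrix.IsHermitian, blockDiagonal'_conjTranspose]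
    congr 1; funext i; exact hρ i
  have hM : (M.submatrix e e).submatrix e.symm e.symm = M := by ext; simp
  rw [← hM, h, entropy_submatrix _ hB, entropy_blockDiagonal' hρ]

/-- Schur concavity: the entropy is at most that of the diagonal. -/
lemma entropy_le_diag {ρ : Matrix ι ι ℂ} (hρ : ρ.PosSemidef) :
    entropy ρ ≤ ∑ i, eta (ρ i i).re := by
  obtain ⟨U, hU, hU', hρU⟩ := exists_unitary_diagonal hρ.1
  -- The diagonal is the spectrum averaged with weights `‖U i k‖ ^ 2`. These form a doubly
  -- stochastic matrix, so Jensen applies row by row and the column sums restore the entropy.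
  have hd : ∀ i, (ρ i i).re = ∑ k, ‖U i k‖ ^ 2 • hρ.1.eigenvalues k := by
    intro i
    have h := congrFun (congrFun hρU i) i
    rw [Matrix.mul_apply] at h
    rw [h, Complex.re_sum]
    refine Finset.sum_congr rfl fun k _ => ?_
    have hc : U i k * star (U i k) = ((‖U i k‖ ^ 2 : ℝ) : ℂ) := by
      rw [RCLike.star_def, Complex.mul_conj, Complex.normSq_eq_norm_sq]
    rw [Matrix.mul_diagonal, conjTranspose_apply, mul_right_comm, hc, ← Complex.ofReal_mul,
      Complex.ofReal_re, smul_eq_mul]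
  have hrow : ∀ i, ∑ k, ‖U i k‖ ^ 2 = 1 := by
    intro i
    have h := congrFun (congrFun hU' i) i
    rw [Matrix.mul_apply] at h
    simp only [conjTranspose_apply, RCLike.star_def, Complex.mul_conj, Complex.normSq_eq_norm_sq,
      Matrix.one_apply_eq, ← Complex.ofReal_sum] at h
    exact_mod_cast h
  have hcol : ∀ k, ∑ i, ‖U i k‖ ^ 2 = 1 := by
    intro k
    have h := congrFun (congrFun hU k) k
    rw [Matrix.mul_apply] at h
    simp only [conjTranspose_apply, RCLike.star_def, mul_comm ((starRingEnd ℂ) _),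
      Complex.mul_conj, Complex.normSq_eq_norm_sq,
      Matrix.one_apply_eq, ← Complex.ofReal_sum] at h
    exact_mod_cast h
  calc entropy ρ = ∑ k, eta (hρ.1.eigenvalues k) := entropy_eq_sum_eta hρ.1
    _ = ∑ k, (∑ i, ‖U i k‖ ^ 2) * eta (hρ.1.eigenvalues k) := by simp [hcol]
    _ = ∑ i, ∑ k, ‖U i k‖ ^ 2 • eta (hρ.1.eigenvalues k) := by
      simp only [Finset.sum_mul, smul_eq_mul]; exact Finset.sum_comm
    _ ≤ ∑ i, eta (ρ i i).re := by
      refine Finset.sum_le_sum fun i _ => ?_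
      rw [hd i]
      exact concaveOn_eta.le_map_sum (fun k _ => by positivity) (hrow i)
        (fun k _ => hρ.eigenvalues_nonneg k)

/-- Subadditivity of entropy on sums of positive operators; equivalently, a classical register
has nonnegative conditional entropy. -/
lemma entropy_sum_le {ρ : κ → Matrix ι ι ℂ} (hρ : ∀ w, (ρ w).PosSemidef) :
    entropy (∑ w, ρ w) ≤ ∑ w, entropy (ρ w) := by
  choose U hU _ hρU using fun w => exists_unitary_diagonal (hρ w).1
  -- The columns of `V` are the eigenvectors of all the `ρ w`, scaled by square roots of
  -- eigenvalues. Then `V * Vᴴ` is the sum of the `ρ w`, while the Gram matrix `Vᴴ * V` has the same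
  -- entropy and carries all the eigenvalues on its diagonal.
  let V : Matrix ι (κ × ι) ℂ := of fun i p =>
    U p.1 i p.2 * (Real.sqrt ((hρ p.1).1.eigenvalues p.2) : ℂ)
  have hsq : ∀ w k, (Real.sqrt ((hρ w).1.eigenvalues k) : ℂ) *
      (Real.sqrt ((hρ w).1.eigenvalues k) : ℂ) = ((hρ w).1.eigenvalues k : ℂ) := by
    intro w k
    rw [← Complex.ofReal_mul, Real.mul_self_sqrt ((hρ w).eigenvalues_nonneg k)]
  have h1 : ∑ w, ρ w = V * Vᴴ := by
    ext i j
    rw [Matrix.sum_apply, Matrix.mul_apply, Fintype.sum_prod_type]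
    refine Finset.sum_congr rfl fun w _ => ?_
    conv_lhs => rw [hρU w]
    rw [Matrix.mul_apply]
    refine Finset.sum_congr rfl fun k _ => ?_
    rw [Matrix.mul_diagonal]
    simp only [V, of_apply, conjTranspose_apply, star_mul', RCLike.star_def, Complex.conj_ofReal]
    rw [← hsq w k]; ring
  have h2 : ∀ p, ((Vᴴ * V) p p).re = (hρ p.1).1.eigenvalues p.2 := by
    rintro ⟨w, k⟩
    have h := congrFun (congrFun (hU w) k) k
    rw [Matrix.mul_apply] at h
    have : (Vᴴ * V) (w, k) (w, k) = ((hρ w).1.eigenvalues k : ℂ) := by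
      rw [← mul_one ((hρ w).1.eigenvalues k : ℂ), ← Matrix.one_apply_eq (α := ℂ) k, ← h,
        Matrix.mul_apply, Finset.mul_sum]
      refine Finset.sum_congr rfl fun i _ => ?_
      simp only [V, of_apply, conjTranspose_apply, star_mul', RCLike.star_def, Complex.conj_ofReal]
      rw [← hsq w k]; ring
    rw [this, Complex.ofReal_re]
  rw [h1, entropy_mul_comm (isHermitian_mul_conjTranspose_self V)
    (isHermitian_conjTranspose_mul_self V)]
  refine (entropy_le_diag (posSemidef_conjTranspose_mul_self V)).trans (le_of_eq ?_)
  simp only [h2]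
  rw [Fintype.sum_prod_type]
  exact Finset.sum_congr rfl fun w _ => (entropy_eq_sum_eta (hρ w).1).symm

end Entropy

/-! ### Partial expectation of local observables. -/

section Contraction

variable {α β κ : Type*} [Fintype α] [Fintype β]

/-- `Tr_{αβ} {(Λ ⊗ Λ' ⊗ I_κ) Y}`. -/
def localContract (Λ : Matrix α α ℂ) (Λ' : Matrix β β ℂ)
    (Y : Matrix (α × β × κ) (α × β × κ) ℂ) : Matrix κ κ ℂ :=
  Matrix.of fun k k' => ∑ s, ∑ s', ∑ t, ∑ t', Λ s' s * Λ' t' t * Y (s, t, k) (s', t', k')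

lemma localContract_sum {u v : Type*} [Fintype u] [Fintype v] (Λ : u → Matrix α α ℂ)
    (Λ' : v → Matrix β β ℂ) (Y : Matrix (α × β × κ) (α × β × κ) ℂ) :
    ∑ i, ∑ j, localContract (Λ i) (Λ' j) Y = localContract (∑ i, Λ i) (∑ j, Λ' j) Y := by
  ext k k'
  simp only [localContract, of_apply, Matrix.sum_apply]
  simp_rw [Finset.sum_mul_sum, Finset.sum_mul]
  simp_rw [Finset.sum_comm (s := (Finset.univ : Finset v))]
  simp_rw [Finset.sum_comm (s := (Finset.univ : Finset u))]

lemma posSemidef_localContract [Finite κ] {Λ : Matrix α α ℂ} {Λ' : Matrix β β ℂ}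
    {Y : Matrix (α × β × κ) (α × β × κ) ℂ} (hΛ : Λ.PosSemidef) (hΛ' : Λ'.PosSemidef)
    (hY : Y.PosSemidef) : (localContract Λ Λ' Y).PosSemidef := by
  classical
  have := Fintype.ofFinite κ
  obtain ⟨m, B, rfl⟩ := posSemidef_iff_eq_sum_vecMulVec.1 hΛ
  obtain ⟨m', B', rfl⟩ := posSemidef_iff_eq_sum_vecMulVec.1 hΛ'
  rw [← localContract_sum]
  refine posSemidef_sum _ fun l _ => posSemidef_sum _ fun l' _ => ?_
  -- For rank-one `Λ` and `Λ'` the contraction is compression by `C`, the tensor product of the two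
  -- vectors with the identity on `κ`.
  let C : Matrix (α × β × κ) κ ℂ := of fun i k => if i.2.2 = k then B l i.1 * B' l' i.2.1 else 0
  have h : localContract (vecMulVec (B l) (star (B l))) (vecMulVec (B' l') (star (B' l'))) Y
      = Cᴴ * Y * C := by
    ext k k'
    simp only [localContract, of_apply, Matrix.mul_apply, conjTranspose_apply, C,
      Fintype.sum_prod_type, vecMulVec_apply, Pi.star_apply]
    simp only [apply_ite star, star_zero, star_mul', ite_mul, mul_ite, zero_mul,
      mul_zero, Finset.sum_ite_eq', Finset.mem_univ, if_true, Finset.sum_mul]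
    rw [Finset.sum_comm]
    refine Finset.sum_congr rfl fun s' _ => ?_
    rw [Finset.sum_comm (s := (Finset.univ : Finset β))]
    refine Finset.sum_congr rfl fun s _ => ?_
    rw [Finset.sum_comm]
    refine Finset.sum_congr rfl fun t' _ => Finset.sum_congr rfl fun t _ => ?_
    ring
  rw [h]
  exact hY.conjTranspose_mul_mul_same C

lemma localContract_one [DecidableEq α] [DecidableEq β] (Y : Matrix (α × β × κ) (α × β × κ) ℂ)
    (k k' : κ) : localContract 1 1 Y k k' = ∑ s, ∑ t, Y (s, t, k) (s, t, k') := by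
  simp [localContract, Matrix.one_apply, Finset.sum_ite_irrel]

end Contraction

/-! ### Tensor powers and products over sites. -/

/-- Schur product theorem. A tensor product becomes an entrywise product once its factors are pulled
back to the common index type, which also covers factors living on different spaces, as in
`partialPow`. -/
lemma posSemidef_prod {ι α : Type*} [Finite α] (s : Finset ι) {F : ι → Matrix α α ℂ}
    (hF : ∀ t, (F t).PosSemidef) : (of fun i j => ∏ t ∈ s, F t i j).PosSemidef := by
  classical
  induction s using Finset.induction_on with
  | empty =>
    have := posSemidef_vecMulVec_self_star (fun _ : α => (1 : ℂ))
    convert this using 1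
    ext; simp [vecMulVec]
  | insert t s ht ih =>
    have h : (of fun i j => ∏ t ∈ insert t s, F t i j) = F t ⊙ of fun i j => ∏ t ∈ s, F t i j := by
      ext i j; simp [Finset.prod_insert ht]
    rw [h]
    exact (hF t).hadamard ih

/-- The tensor power `ρ^{⊗k}`. -/
def tensorPow {ι : Type*} (ρ : Matrix ι ι ℂ) (k : ℕ) : Matrix (Fin k → ι) (Fin k → ι) ℂ :=
  of fun f f' => ∏ t, ρ (f t) (f' t)

lemma trace_tensorPow {ι : Type*} [Fintype ι] (ρ : Matrix ι ι ℂ) (k : ℕ) :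
    (tensorPow ρ k).trace = ρ.trace ^ k := by
  simp only [Matrix.trace, tensorPow, diag_apply, of_apply]
  exact (Fintype.sum_pow (fun i => ρ i i) k).symm

lemma posSemidef_tensorPow {ι : Type*} [Finite ι] {ρ : Matrix ι ι ℂ} (hρ : ρ.PosSemidef) (k : ℕ) :
    (tensorPow ρ k).PosSemidef :=
  posSemidef_prod Finset.univ fun t : Fin k => hρ.submatrix fun f : Fin k → ι => f t

lemma entropy_tensorPow {ι : Type*} [Fintype ι] [DecidableEq ι] {ρ : Matrix ι ι ℂ}
    (hρ : IsDensity ρ) (k : ℕ) : entropy (tensorPow ρ k) = k * entropy ρ := by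
  induction k with
  | zero =>
    rw [entropy_unique (posSemidef_tensorPow hρ.1 0).1, trace_tensorPow]
    simp
  | succ k ih =>
    have h : (tensorPow ρ (k + 1)).submatrix (Fin.consEquiv fun _ => ι) (Fin.consEquiv fun _ => ι)
        = ρ ⊗ₖ tensorPow ρ k := by
      ext i j
      simp [tensorPow, Fin.prod_univ_succ, Fin.consEquiv]
    rw [← entropy_submatrix _ (posSemidef_tensorPow hρ.1 (k + 1)).1 (Fin.consEquiv fun _ => ι), h,
      entropy_kronecker hρ.1.1 (posSemidef_tensorPow hρ.1 k).1, trace_tensorPow, hρ.2, ih]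
    push_cast
    simp
    ring

lemma prod_dite_lt {M : Type*} [CommMonoid M] {n k : ℕ} (hk : k ≤ n) (A : Fin k → M)
    (B : Fin n → M) :
    ∏ t : Fin n, (if h : t.1 < k then A ⟨t, h⟩ else B t) =
      (∏ t, A t) * ∏ t : Fin n, if t.1 < k then 1 else B t := by
  obtain ⟨l, rfl⟩ := Nat.exists_eq_add_of_le hk
  simp [Fin.prod_univ_add]

lemma sum_sum_prod {ι α β : Type*} [Fintype ι] [DecidableEq ι] [Fintype α] [Fintype β]
    (g : ι → α → β → ℂ) :
    ∑ p : ι → α, ∑ q : ι → β, ∏ t, g t (p t) (q t) = ∏ t, ∑ i, ∑ j, g t i j := by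
  have h : ∀ p : ι → α, ∑ q : ι → β, ∏ t, g t (p t) (q t) = ∏ t, ∑ j, g t (p t) j := by
    intro p
    rw [Finset.prod_univ_sum, Fintype.piFinset_univ]
  simp only [h]
  rw [Finset.prod_univ_sum, Fintype.piFinset_univ]

/-! ### Partially traced powers of the source and post-measurement reference states. -/

section Source

variable {r a b x : Type*} [Fintype r] [Fintype a] [Fintype b] [Fintype x]

lemma Setup.posSemidef_Ψ (s : Setup r a b x) : s.Ψ.PosSemidef :=
  posSemidef_vecMulVec_self_star _

lemma Setup.trace_Ψ (s : Setup r a b x) : s.Ψ.trace = 1 := by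
  simp only [Matrix.trace, Setup.Ψ, diag_apply, vecMulVec_apply, Pi.star_apply, RCLike.star_def,
    Complex.mul_conj, Complex.normSq_eq_norm_sq, ← Complex.ofReal_sum, s.ψ_norm]
  simp

lemma trace_trLeft {α β : Type*} [Fintype α] [Fintype β] (M : Matrix (α × β) (α × β) ℂ) :
    (trLeft M).trace = M.trace := by
  simp only [Matrix.trace, trLeft, diag_apply, of_apply, Fintype.sum_prod_type]
  exact Finset.sum_comm

lemma trace_trRight {α β : Type*} [Fintype α] [Fintype β] (M : Matrix (α × β) (α × β) ℂ) :
    (trRight M).trace = M.trace := by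
  simp only [Matrix.trace, trRight, diag_apply, of_apply, Fintype.sum_prod_type]

lemma posSemidef_trLeft {α β : Type*} [Fintype α] [Finite β] {M : Matrix (α × β) (α × β) ℂ}
    (hM : M.PosSemidef) : (trLeft M).PosSemidef := by
  have h : trLeft M = ∑ k, M.submatrix (fun j => (k, j)) (fun j => (k, j)) := by
    ext; simp [trLeft, Matrix.sum_apply]
  rw [h]
  exact posSemidef_sum _ fun k _ => hM.submatrix _

lemma posSemidef_trRight {α β : Type*} [Finite α] [Fintype β] {M : Matrix (α × β) (α × β) ℂ}
    (hM : M.PosSemidef) : (trRight M).PosSemidef := by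
  have h : trRight M = ∑ k, M.submatrix (fun j => (j, k)) (fun j => (j, k)) := by
    ext; simp [trRight, Matrix.sum_apply]
  rw [h]
  exact posSemidef_sum _ fun k _ => hM.submatrix _

lemma Setup.isDensity_reference (s : Setup r a b x) : IsDensity (trRight s.Ψ) :=
  ⟨posSemidef_trRight s.posSemidef_Ψ, by rw [trace_trRight, s.trace_Ψ]⟩

/-- The marginal of `|ψ⟩⟨ψ|^{⊗n}` on `A^n ⊗ B^n ⊗ R^k`, for `k ≤ n`. -/
def Setup.partialPow (s : Setup r a b x) (n k : ℕ) :
    Matrix ((Fin n → a) × (Fin n → b) × (Fin k → r))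
      ((Fin n → a) × (Fin n → b) × (Fin k → r)) ℂ :=
  of fun i i' => ∏ t : Fin n,
    if h : t.1 < k then
      s.Ψ (i.2.2 ⟨t, h⟩, i.1 t, i.2.1 t) (i'.2.2 ⟨t, h⟩, i'.1 t, i'.2.1 t)
    else trLeft s.Ψ (i.1 t, i.2.1 t) (i'.1 t, i'.2.1 t)

lemma Setup.posSemidef_partialPow (s : Setup r a b x) (n k : ℕ) :
    (s.partialPow n k).PosSemidef := by
  let F : Fin n → Matrix ((Fin n → a) × (Fin n → b) × (Fin k → r))
      ((Fin n → a) × (Fin n → b) × (Fin k → r)) ℂ := fun t => of fun i i' =>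
    if h : t.1 < k then
      s.Ψ (i.2.2 ⟨t, h⟩, i.1 t, i.2.1 t) (i'.2.2 ⟨t, h⟩, i'.1 t, i'.2.1 t)
    else trLeft s.Ψ (i.1 t, i.2.1 t) (i'.1 t, i'.2.1 t)
  refine posSemidef_prod Finset.univ (F := F) fun t => ?_
  by_cases h : t.1 < k
  · simp only [F, h, dite_true]
    exact s.posSemidef_Ψ.submatrix fun i : (Fin n → a) × (Fin n → b) × (Fin k → r) =>
      (i.2.2 ⟨t, h⟩, i.1 t, i.2.1 t)
  · simp only [F, h, dite_false]
    exact (posSemidef_trLeft s.posSemidef_Ψ).submatrix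
      fun i : (Fin n → a) × (Fin n → b) × (Fin k → r) => (i.1 t, i.2.1 t)

lemma Setup.sum_partialPow (s : Setup r a b x) {n k : ℕ} (hk : k ≤ n) (f f' : Fin k → r) :
    ∑ p, ∑ q, s.partialPow n k (p, q, f) (p, q, f') = tensorPow (trRight s.Ψ) k f f' := by
  simp only [Setup.partialPow, of_apply]
  rw [sum_sum_prod (fun (t : Fin n) i j => if h : t.1 < k then s.Ψ (f ⟨t, h⟩, i, j) (f' ⟨t, h⟩, i, j)
    else trLeft s.Ψ (i, j) (i, j))]
  have h1 : ∀ t : Fin n, (∑ i, ∑ j, if h : t.1 < k then s.Ψ (f ⟨t, h⟩, i, j) (f' ⟨t, h⟩, i, j)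
      else trLeft s.Ψ (i, j) (i, j)) =
      if h : t.1 < k then trRight s.Ψ (f ⟨t, h⟩) (f' ⟨t, h⟩) else 1 := by
    intro t
    split_ifs with h
    · simp [trRight, Fintype.sum_prod_type]
    · rw [← s.trace_Ψ, ← trace_trLeft]
      simp [Matrix.trace, Fintype.sum_prod_type]
  simp only [h1]
  rw [prod_dite_lt hk (fun t => trRight s.Ψ (f t) (f' t)) fun _ => 1]
  simp [tensorPow]

lemma Setup.isDensity_partialPow (s : Setup r a b x) {n k : ℕ} (hk : k ≤ n) :
    IsDensity (s.partialPow n k) := by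
  refine ⟨s.posSemidef_partialPow n k, ?_⟩
  have h : (s.partialPow n k).trace =
      ∑ f, ∑ p, ∑ q, s.partialPow n k (p, q, f) (p, q, f) := by
    simp only [Matrix.trace, diag_apply, Fintype.sum_prod_type]
    simp_rw [Finset.sum_comm (t := (Finset.univ : Finset (Fin k → r)))]
  rw [h]
  simp only [s.sum_partialPow hk]
  change (tensorPow (trRight s.Ψ) k).trace = 1
  rw [trace_tensorPow, s.isDensity_reference.2, one_pow]

/-- Site `j` is the last of the `j + 1` sites whose reference is kept. Deleting it leaves `m` sites
of which exactly the first `j` keep theirs, so the state factors into a fresh `ψ` and the shared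
state. -/
lemma Setup.partialPow_succ (s : Setup r a b x) {m : ℕ} (j : Fin (m + 1))
    (y y' : a) (z z' : b) (p p' : Fin m → a) (q q' : Fin m → b) (w w' : r)
    (f f' : Fin (j : ℕ) → r) :
    s.partialPow (m + 1) (j + 1) (j.insertNth y p, j.insertNth z q, Fin.snoc f w)
      (j.insertNth y' p', j.insertNth z' q', Fin.snoc f' w') =
    s.Ψ (w, y, z) (w', y', z') * s.partialPow m j (p, q, f) (p', q', f') := by
  simp only [Setup.partialPow, of_apply]
  rw [Fin.prod_univ_succAbove _ j]
  congr 1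
  · simp [Fin.snoc]
  · refine Finset.prod_congr rfl fun t _ => ?_
    by_cases h : t.1 < j.1
    · have h1 : (j.succAbove t).1 = t.1 := by
        rw [Fin.succAbove_of_castSucc_lt _ _ (by simpa [Fin.lt_def] using h)]; simp
      simp [h1, h, Fin.snoc, Nat.lt_succ_of_lt h]
    · have h1 : (j.succAbove t).1 = t.1 + 1 := by
        rw [Fin.succAbove_of_le_castSucc _ _ (by simpa [Fin.le_def] using h)]; simp
      simp [h1, h]

/-- With only `j` references kept, site `j` is the first to lose its own. Comparison with
`partialPow_succ` gives the consistency of the marginals. -/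
lemma Setup.partialPow_castSucc (s : Setup r a b x) {m : ℕ} (j : Fin (m + 1))
    (y y' : a) (z z' : b) (p p' : Fin m → a) (q q' : Fin m → b) (f f' : Fin (j : ℕ) → r) :
    s.partialPow (m + 1) j (j.insertNth y p, j.insertNth z q, f)
      (j.insertNth y' p', j.insertNth z' q', f') =
    trLeft s.Ψ (y, z) (y', z') * s.partialPow m j (p, q, f) (p', q', f') := by
  simp only [Setup.partialPow, of_apply]
  rw [Fin.prod_univ_succAbove _ j]
  congr 1
  · simp
  · refine Finset.prod_congr rfl fun t _ => ?_
    by_cases h : t.1 < j.1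
    · have h1 : (j.succAbove t).1 = t.1 := by
        rw [Fin.succAbove_of_castSucc_lt _ _ (by simpa [Fin.lt_def] using h)]; simp
      simp [h1, h]
    · have h1 : (j.succAbove t).1 = t.1 + 1 := by
        rw [Fin.succAbove_of_le_castSucc _ _ (by simpa [Fin.le_def] using h)]; simp
      have h2 : ¬ t.1 + 1 < j.1 := by omega
      simp [h1, h, h2]

lemma Setup.sum_partialPow_snoc (s : Setup r a b x) {m : ℕ} (j : Fin (m + 1))
    (p p' : Fin (m + 1) → a) (q q' : Fin (m + 1) → b) (f f' : Fin (j : ℕ) → r) :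
    ∑ w, s.partialPow (m + 1) (j + 1) (p, q, Fin.snoc f w) (p', q', Fin.snoc f' w) =
      s.partialPow (m + 1) j (p, q, f) (p', q', f') := by
  rw [← Fin.insertNth_self_removeNth j p, ← Fin.insertNth_self_removeNth j p',
    ← Fin.insertNth_self_removeNth j q, ← Fin.insertNth_self_removeNth j q']
  simp only [s.partialPow_succ, s.partialPow_castSucc, ← Finset.sum_mul]
  rfl

/-- The unnormalised state of `R^k` after outcomes `Λ`, `Λ'` of measurements of `A^n`, `B^n`. -/
def Setup.post (s : Setup r a b x) (n k : ℕ) (Λ : Matrix (Fin n → a) (Fin n → a) ℂ)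
    (Λ' : Matrix (Fin n → b) (Fin n → b) ℂ) : Matrix (Fin k → r) (Fin k → r) ℂ :=
  localContract Λ Λ' (s.partialPow n k)

lemma Setup.sum_post_snoc (s : Setup r a b x) {m : ℕ} (j : Fin (m + 1))
    (Λ : Matrix (Fin (m + 1) → a) (Fin (m + 1) → a) ℂ)
    (Λ' : Matrix (Fin (m + 1) → b) (Fin (m + 1) → b) ℂ) (f f' : Fin (j : ℕ) → r) :
    ∑ w, s.post (m + 1) (j + 1) Λ Λ' (Fin.snoc f w) (Fin.snoc f' w) =
      s.post (m + 1) j Λ Λ' f f' := by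
  simp only [Setup.post, localContract, of_apply, ← s.sum_partialPow_snoc, Finset.mul_sum]
  rw [Finset.sum_comm]; refine Finset.sum_congr rfl fun _ _ => ?_
  rw [Finset.sum_comm]; refine Finset.sum_congr rfl fun _ _ => ?_
  rw [Finset.sum_comm]; refine Finset.sum_congr rfl fun _ _ => ?_
  rw [Finset.sum_comm]

/-- Measuring a fresh copy of `ψ` in position `j` together with the shared state gives the
conditional state of the first `j + 1` reference systems. -/
lemma Setup.measured_partialPow (s : Setup r a b x) {m : ℕ} (j : Fin (m + 1))
    (Λ : Matrix (Fin (m + 1) → a) (Fin (m + 1) → a) ℂ)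
    (Λ' : Matrix (Fin (m + 1) → b) (Fin (m + 1) → b) ℂ) (f f' : Fin (j : ℕ) → r) (w w' : r) :
    measured (Λ.submatrix (Fin.insertNthEquiv (fun _ => a) j) (Fin.insertNthEquiv (fun _ => a) j))
      (Λ'.submatrix (Fin.insertNthEquiv (fun _ => b) j) (Fin.insertNthEquiv (fun _ => b) j))
      (of fun y y' => s.Ψ (w, y) (w', y')) (s.partialPow m j) f f' =
    s.post (m + 1) (j + 1) Λ Λ' (Fin.snoc f w) (Fin.snoc f' w') := by
  simp only [measured, Setup.post, localContract, of_apply, submatrix_apply]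
  rw [← (Fin.insertNthEquiv (fun _ => a) j).sum_comp]
  refine Finset.sum_congr rfl fun p _ => ?_
  rw [← (Fin.insertNthEquiv (fun _ => a) j).sum_comp]
  refine Finset.sum_congr rfl fun p' _ => ?_
  rw [← (Fin.insertNthEquiv (fun _ => b) j).sum_comp]
  refine Finset.sum_congr rfl fun q _ => ?_
  rw [← (Fin.insertNthEquiv (fun _ => b) j).sum_comp]
  refine Finset.sum_congr rfl fun q' _ => ?_
  simp only [Fin.insertNthEquiv, Equiv.coe_fn_mk, s.partialPow_succ]
  ring

lemma Setup.posSemidef_post (s : Setup r a b x) (n k : ℕ)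
    {Λ : Matrix (Fin n → a) (Fin n → a) ℂ} {Λ' : Matrix (Fin n → b) (Fin n → b) ℂ}
    (hΛ : Λ.PosSemidef) (hΛ' : Λ'.PosSemidef) : (s.post n k Λ Λ').PosSemidef :=
  posSemidef_localContract hΛ hΛ' (s.posSemidef_partialPow n k)

/-- Local measurements, averaged over their outcomes, do not disturb the references. This is what
makes `R` independent of `Q`. -/
lemma Setup.sum_post [DecidableEq a] [DecidableEq b] (s : Setup r a b x) {n k : ℕ} (hk : k ≤ n)
    {u v : Type*} [Fintype u] [Fintype v]
    {Λ : u → Matrix (Fin n → a) (Fin n → a) ℂ} {Λ' : v → Matrix (Fin n → b) (Fin n → b) ℂ}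
    (hΛ : IsPOVM Λ) (hΛ' : IsPOVM Λ') :
    ∑ i, ∑ j, s.post n k (Λ i) (Λ' j) = tensorPow (trRight s.Ψ) k := by
  simp only [Setup.post, localContract_sum, hΛ.2, hΛ'.2]
  ext f f'
  rw [localContract_one, s.sum_partialPow hk]

end Source

/-! ### Block-diagonal states and classical registers. -/

lemma posSemidef_blockDiagonal' {ι : Type*} [Fintype ι] [DecidableEq ι] {β : ι → Type*}
    [∀ i, Fintype (β i)] {ρ : ∀ i, Matrix (β i) (β i) ℂ} (hρ : ∀ i, (ρ i).PosSemidef) :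
    (blockDiagonal' ρ).PosSemidef := by
  classical
  refine PosSemidef.of_dotProduct_mulVec_nonneg ?_ fun y => ?_
  · rw [Matrix.IsHermitian, blockDiagonal'_conjTranspose]
    congr 1; funext i; exact (hρ i).1
  · have h : star y ⬝ᵥ (blockDiagonal' ρ *ᵥ y) =
        ∑ i, star (fun k => y ⟨i, k⟩) ⬝ᵥ (ρ i *ᵥ fun k => y ⟨i, k⟩) := by
      simp only [dotProduct, mulVec, Fintype.sum_sigma, Pi.star_apply]
      refine Finset.sum_congr rfl fun i _ => Finset.sum_congr rfl fun k _ => ?_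
      congr 1
      rw [Finset.sum_eq_single i]
      · simp
      · intro j _ hj
        exact Finset.sum_eq_zero fun l _ => by rw [blockDiagonal'_apply_ne _ _ _ hj.symm, zero_mul]
      · simp
    rw [h]
    exact Finset.sum_nonneg fun i _ => (hρ i).dotProduct_mulVec_nonneg _

/-- The equivalence `e` allows the classical register to sit anywhere in the tensor ordering. The
blocks are unnormalised, so no separate Shannon term appears. -/
lemma entropy_of_classical {ι β κ : Type*} [Fintype ι] [DecidableEq ι] [Fintype β]
    [DecidableEq β] [Fintype κ] [DecidableEq κ] {ρ : ι → Matrix β β ℂ}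
    (hρ : ∀ i, (ρ i).IsHermitian) {M : Matrix κ κ ℂ} (e : ι × β ≃ κ)
    (h : ∀ i i' y y', M (e (i, y)) (e (i', y')) = if i = i' then ρ i y y' else 0) :
    entropy M = ∑ i, entropy (ρ i) := by
  refine entropy_of_submatrix_eq_blockDiagonal' hρ ((Equiv.sigmaEquivProd ι β).trans e) ?_
  ext ⟨i, y⟩ ⟨i', y'⟩
  simp only [submatrix_apply, Equiv.trans_apply, Equiv.sigmaEquivProd_apply, h]
  split_ifs with hi
  · subst hi; rw [blockDiagonal'_apply_eq]
  · rw [blockDiagonal'_apply_ne _ _ _ hi]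

section ClassicalQuantum

variable {u v r q : Type*} [Fintype u] [Fintype v] [Fintype r] [Fintype q]
  [DecidableEq u] [DecidableEq v] [DecidableEq r] [DecidableEq q]

lemma trLeft_sum (d : u → Matrix (r × q) (r × q) ℂ) : ∑ i, trLeft (d i) = trLeft (∑ i, d i) := by
  ext k k'
  simp only [trLeft, Matrix.sum_apply, of_apply]
  exact Finset.sum_comm

/-- The conditional mutual information of a state with classical first register. -/
lemma condMutualInfo_classical {d : u → Matrix (r × q) (r × q) ℂ} (hd : ∀ i, (d i).PosSemidef) :
    condMutualInfo (of fun i i' : u × r × q => if i.1 = i'.1 then d i.1 i.2 i'.2 else 0) =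
      ∑ i, entropy (trLeft (d i)) + entropy (∑ i, d i) - entropy (trLeft (∑ i, d i)) -
        ∑ i, entropy (d i) := by
  have h0 : trLeft (of fun i i' : u × r × q => if i.1 = i'.1 then d i.1 i.2 i'.2 else 0) =
      ∑ i, d i := by
    ext; simp [trLeft, Matrix.sum_apply]
  rw [condMutualInfo, h0, entropy_of_classical (fun i => (hd i).1) (Equiv.refl _),
    entropy_of_classical (fun i => (posSemidef_trLeft (hd i)).1) (Equiv.refl _)]
  · intro i i' y y'
    simp only [trMid, trLeft, of_apply, Equiv.refl_apply]
    split_ifs <;> simp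
  · intro i i' y y'
    simp

/-- The conditional mutual information of a state with classical first register, given a second
classical register and a quantum one. -/
lemma condMutualInfo_classical₂ {d : u → v → Matrix (r × q) (r × q) ℂ}
    (hd : ∀ i j, (d i j).PosSemidef) :
    condMutualInfo (of fun i i' : u × r × v × q => if i.1 = i'.1 ∧ i.2.2.1 = i'.2.2.1 then
        d i.1 i.2.2.1 (i.2.1, i.2.2.2) (i'.2.1, i'.2.2.2) else 0) =
      ∑ j, (∑ i, entropy (trLeft (d i j)) + entropy (∑ i, d i j) -
        entropy (trLeft (∑ i, d i j)) - ∑ i, entropy (d i j)) := by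
  have hs : ∀ j, (∑ i, d i j).PosSemidef := fun j => posSemidef_sum _ fun i _ => hd i j
  rw [condMutualInfo]
  simp only [Finset.sum_sub_distrib, Finset.sum_add_distrib]
  congr 1
  · congr 1
    · congr 1
      · rw [Finset.sum_comm, ← Fintype.sum_prod_type',
          entropy_of_classical (fun p : u × v => (posSemidef_trLeft (hd p.1 p.2)).1)
            (Equiv.prodAssoc u v q)]
        rintro ⟨i, j⟩ ⟨i', j'⟩ y y'
        simp only [trMid, trLeft, of_apply, Equiv.prodAssoc_apply, Prod.mk.injEq]
        split_ifs <;> simp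
      · rw [entropy_of_classical (fun j => (hs j).1)
          ((Equiv.prodAssoc v r q).symm.trans (((Equiv.prodComm v r).prodCongr
            (Equiv.refl q)).trans (Equiv.prodAssoc r v q)))]
        rintro j j' ⟨w, y⟩ ⟨w', y'⟩
        simp [trLeft, Matrix.sum_apply, Finset.sum_ite_irrel]
    · rw [entropy_of_classical (fun j => (posSemidef_trLeft (hs j)).1) (Equiv.refl _)]
      rintro j j' y y'
      by_cases h : j = j' <;> simp [trLeft, Matrix.sum_apply, h]
  · rw [Finset.sum_comm, ← Fintype.sum_prod_type',
      entropy_of_classical (fun p : u × v => (hd p.1 p.2).1)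
        ((Equiv.prodProdProdComm u v r q).trans ((Equiv.prodAssoc u r (v × q))))]
    rintro ⟨i, j⟩ ⟨i', j'⟩ ⟨w, y⟩ ⟨w', y'⟩
    simp

end ClassicalQuantum

/-! ### The memory `Q` and the telescoping chain rule. -/

section Blocks

variable {r : Type*} [Fintype r] [DecidableEq r]

/-- The state of `R ⊗ Q` when `Q = (j, R^j)` for a uniform `j` and `R` is the next system. -/
noncomputable def refBlock (m : ℕ) (T : ∀ k, Matrix (Fin k → r) (Fin k → r) ℂ) :
    Matrix (r × Fock r (m + 1)) (r × Fock r (m + 1)) ℂ :=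
  of fun i i' => blockDiagonal' (fun j : Fin (m + 1) => of fun f f' =>
    1 / ((m : ℂ) + 1) * T (j + 1) (Fin.snoc f i.1) (Fin.snoc f' i'.1)) i.2 i'.2

/-- The state of `Q = (j, R^j)` for a uniform `j`. -/
noncomputable def memBlock (m : ℕ) (T : ∀ k, Matrix (Fin k → r) (Fin k → r) ℂ) :
    Matrix (Fock r (m + 1)) (Fock r (m + 1)) ℂ :=
  blockDiagonal' fun j : Fin (m + 1) => (1 / ((m : ℂ) + 1)) • T j

/-- Each matrix of the family is the marginal of the next one, up to `k = m + 1`. -/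
def Consistent (m : ℕ) (T : ∀ k, Matrix (Fin k → r) (Fin k → r) ℂ) : Prop :=
  ∀ k ≤ m, ∀ f f', ∑ w, T (k + 1) (Fin.snoc f w) (Fin.snoc f' w) = T k f f'

lemma Consistent.sum {ι : Type*} [Fintype ι] {m : ℕ}
    {T : ι → ∀ k, Matrix (Fin k → r) (Fin k → r) ℂ} (hT : ∀ i, Consistent m (T i)) :
    Consistent m (∑ i, T i) := by
  intro k hk f f'
  simp only [Finset.sum_apply, Matrix.sum_apply]
  rw [Finset.sum_comm]
  exact Finset.sum_congr rfl fun i _ => hT i k hk f f'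

lemma refBlock_sum {ι : Type*} [Fintype ι] (m : ℕ)
    (T : ι → ∀ k, Matrix (Fin k → r) (Fin k → r) ℂ) :
    ∑ i, refBlock m (T i) = refBlock m (∑ i, T i) := by
  ext ⟨w, j, f⟩ ⟨w', j', f'⟩
  simp only [refBlock, of_apply, Matrix.sum_apply]
  by_cases h : j = j'
  · subst h
    simp only [blockDiagonal'_apply_eq, of_apply, Finset.sum_apply, Matrix.sum_apply,
      Finset.mul_sum]
  · simp only [blockDiagonal'_apply_ne _ _ _ h, Finset.sum_const_zero]

lemma trLeft_refBlock {m : ℕ} {T : ∀ k, Matrix (Fin k → r) (Fin k → r) ℂ}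
    (hT : Consistent m T) : trLeft (refBlock m T) = memBlock m T := by
  ext ⟨j, f⟩ ⟨j', f'⟩
  simp only [refBlock, memBlock, trLeft, of_apply]
  by_cases h : j = j'
  · subst h
    simp only [blockDiagonal'_apply_eq, of_apply, Matrix.smul_apply, smul_eq_mul,
      ← Finset.mul_sum, hT j (Nat.lt_succ_iff.1 j.2)]
  · simp only [blockDiagonal'_apply_ne _ _ _ h, Finset.sum_const_zero]

/-- The regrouping `⊕_j R^{j+1} ≃ R ⊗ ⊕_j R^j`. -/
def fockEquiv (r : Type*) (n : ℕ) : (Σ j : Fin n, (Fin ((j : ℕ) + 1) → r)) ≃ r × Fock r n where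
  toFun p := (p.2 (Fin.last _), ⟨p.1, Fin.init p.2⟩)
  invFun p := ⟨p.2.1, Fin.snoc p.2.2 p.1⟩
  left_inv p := by simp
  right_inv p := by simp

lemma one_div_cast (m : ℕ) : (1 / ((m : ℂ) + 1)) = ((1 / ((m : ℝ) + 1) : ℝ) : ℂ) := by
  push_cast; rfl

/-- Within block `j`, appending `R` to the `j` earlier references gives `j + 1` references, so `R ⊗
Q` is itself a direct sum over `j`. -/
lemma refBlock_submatrix (m : ℕ) (T : ∀ k, Matrix (Fin k → r) (Fin k → r) ℂ) :
    (refBlock m T).submatrix (fockEquiv r (m + 1)) (fockEquiv r (m + 1)) =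
      blockDiagonal' fun j : Fin (m + 1) => ((1 / ((m : ℝ) + 1) : ℝ) : ℂ) • T (j + 1) := by
  ext ⟨j, f⟩ ⟨j', f'⟩
  simp only [refBlock, submatrix_apply, of_apply, fockEquiv, Equiv.coe_fn_mk]
  by_cases h : j = j'
  · subst h
    simp only [blockDiagonal'_apply_eq, of_apply, Matrix.smul_apply, smul_eq_mul,
      Fin.snoc_init_self, one_div_cast]
  · simp only [blockDiagonal'_apply_ne _ _ _ h]

lemma posSemidef_refBlock {m : ℕ} {T : ∀ k, Matrix (Fin k → r) (Fin k → r) ℂ}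
    (hT : ∀ k, (T k).PosSemidef) : (refBlock m T).PosSemidef := by
  rw [← posSemidef_submatrix_equiv (fockEquiv r (m + 1)), refBlock_submatrix]
  refine posSemidef_blockDiagonal' fun j => (hT _).smul ?_
  rw [Complex.zero_le_real]; positivity

lemma entropy_refBlock {m : ℕ} {T : ∀ k, Matrix (Fin k → r) (Fin k → r) ℂ}
    (hT : ∀ k, (T k).PosSemidef) :
    entropy (refBlock m T) = ∑ j : Fin (m + 1), (1 / ((m : ℝ) + 1) * entropy (T (j + 1)) +
      (T (j + 1)).trace.re * eta (1 / ((m : ℝ) + 1))) := by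
  rw [entropy_of_submatrix_eq_blockDiagonal' _ _ (refBlock_submatrix m T)]
  · exact Finset.sum_congr rfl fun j _ => entropy_smul (hT _).1 _
  · intro j
    exact ((hT _).smul (by rw [Complex.zero_le_real]; positivity)).1

lemma entropy_memBlock {m : ℕ} {T : ∀ k, Matrix (Fin k → r) (Fin k → r) ℂ}
    (hT : ∀ k, (T k).PosSemidef) :
    entropy (memBlock m T) = ∑ j : Fin (m + 1), (1 / ((m : ℝ) + 1) * entropy (T j) +
      (T j).trace.re * eta (1 / ((m : ℝ) + 1))) := by
  rw [memBlock, entropy_blockDiagonal']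
  · refine Finset.sum_congr rfl fun j _ => ?_
    rw [one_div_cast, entropy_smul (hT _).1]
  · intro j
    rw [one_div_cast]
    exact ((hT _).smul (by rw [Complex.zero_le_real]; positivity)).1

lemma Consistent.trace_succ {m k : ℕ} {T : ∀ k, Matrix (Fin k → r) (Fin k → r) ℂ}
    (hT : Consistent m T) (hk : k ≤ m) : (T (k + 1)).trace = (T k).trace := by
  simp only [Matrix.trace, diag_apply]
  simp only [← hT k hk]
  rw [← (Fin.snocEquiv fun _ => r).sum_comp, Fintype.sum_prod_type, Finset.sum_comm]
  rfl

/-- Chain rule: the conditional entropies of `R` given `Q` telescope. -/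
lemma entropy_refBlock_sub {m : ℕ} {T : ∀ k, Matrix (Fin k → r) (Fin k → r) ℂ}
    (hT : ∀ k, (T k).PosSemidef) (hc : Consistent m T) :
    entropy (refBlock m T) - entropy (memBlock m T) =
      1 / ((m : ℝ) + 1) * (entropy (T (m + 1)) - entropy (T 0)) := by
  rw [entropy_refBlock hT, entropy_memBlock hT, ← Finset.sum_sub_distrib]
  rw [← Finset.sum_range_sub (fun k => entropy (T k)), Finset.mul_sum,
    ← Fin.sum_univ_eq_sum_range (fun k => 1 / ((m : ℝ) + 1) * (entropy (T (k + 1)) - entropy (T k)))]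
  refine Finset.sum_congr rfl fun j _ => ?_
  -- Equal traces make the `eta (1 / (m + 1))` terms, the entropy of the uniform index `j`, cancel.
  rw [hc.trace_succ (Nat.lt_succ_iff.1 j.2)]
  ring

lemma sum_family_apply {ι : Type*} [Fintype ι] (T : ι → ∀ k, Matrix (Fin k → r) (Fin k → r) ℂ)
    (k : ℕ) : (∑ i, T i) k = ∑ i, T i k := Finset.sum_apply _ _ _

/-- A classical register with `|u|` values carries at most `log₂ |u|` bits about `R^{m+1}`. -/
lemma classical_information_le {u : Type*} [Fintype u] [DecidableEq u] {m : ℕ}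
    {T : u → ∀ k, Matrix (Fin k → r) (Fin k → r) ℂ} (hT : ∀ i k, (T i k).PosSemidef)
    (hc : ∀ i, Consistent m (T i)) :
    ∑ i, entropy (trLeft (refBlock m (T i))) + entropy (∑ i, refBlock m (T i)) -
        entropy (trLeft (∑ i, refBlock m (T i))) - ∑ i, entropy (refBlock m (T i)) ≤
      1 / ((m : ℝ) + 1) * ((∑ i, (T i 0).trace.re) * Real.logb 2 (Fintype.card u)) := by
  have hs : ∀ k, ((∑ i, T i) k).PosSemidef := fun k => by
    rw [sum_family_apply]; exact posSemidef_sum _ fun i _ => hT i k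
  have h1 := entropy_refBlock_sub hs (Consistent.sum hc)
  have h2 : ∑ i, entropy (refBlock m (T i)) - ∑ i, entropy (memBlock m (T i)) =
      1 / ((m : ℝ) + 1) * (∑ i, entropy (T i (m + 1)) - ∑ i, entropy (T i 0)) := by
    rw [← Finset.sum_sub_distrib, ← Finset.sum_sub_distrib, Finset.mul_sum]
    exact Finset.sum_congr rfl fun i _ => entropy_refBlock_sub (hT i) (hc i)
  -- The two ends of the telescope: on all `m + 1` references the entropy of the sum is at most the
  -- sum of entropies. On none (`h4`), only the outcome probabilities remain, and `sum_eta_le`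
  -- bounds their entropy.
  have h3 := entropy_sum_le fun i => hT i (m + 1)
  have h4 : ∑ i, entropy (T i 0) ≤ entropy ((∑ i, T i) 0) +
      (∑ i, (T i 0).trace.re) * Real.logb 2 (Fintype.card u) := by
    have h := sum_eta_le (p := fun i => (T i 0).trace.re)
      fun i => (Complex.nonneg_iff.1 (hT i 0).trace_nonneg).1
    have h' : ((∑ i, T i) 0).trace.re = ∑ i, (T i 0).trace.re := by
      rw [sum_family_apply, Matrix.trace_sum, Complex.re_sum]
    rw [entropy_unique (hs 0).1, h']
    refine le_trans (le_of_eq ?_) h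
    exact Finset.sum_congr rfl fun i _ => entropy_unique (hT i 0).1
  simp only [refBlock_sum, trLeft_refBlock (Consistent.sum hc), trLeft_refBlock (hc _)]
  have hn : (0 : ℝ) ≤ 1 / ((m : ℝ) + 1) := by positivity
  rw [← sum_family_apply] at h3
  have h5 := mul_le_mul_of_nonneg_left (add_le_add h3 h4) hn
  linarith

/-- For a tensor power the telescope gives `S(RQ) - S(Q) = S(ρ)`, which is `S(R)`. -/
lemma mutualInfo_refBlock_tensorPow (m : ℕ) {ρ : Matrix r r ℂ} (hρ : IsDensity ρ) :
    mutualInfo (refBlock m (tensorPow ρ)) = 0 := by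
  have hsnoc : ∀ (k : ℕ) (f f' : Fin k → r) (w w' : r), tensorPow ρ (k + 1) (Fin.snoc f w)
      (Fin.snoc f' w') = tensorPow ρ k f f' * ρ w w' := by
    intro k f f' w w'
    simp [tensorPow, Fin.prod_univ_castSucc]
  have hc : Consistent m (tensorPow ρ) := by
    intro k _ f f'
    have := hρ.2
    simp only [Matrix.trace, diag_apply] at this
    simp only [hsnoc, ← Finset.mul_sum, this, mul_one]
  have hR : trRight (refBlock m (tensorPow ρ)) = ρ := by
    ext w w'
    have ht : ∀ k, ∑ f, tensorPow ρ k f f = 1 := fun k => by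
      have := trace_tensorPow ρ k
      rwa [hρ.2, one_pow] at this
    simp only [trRight, refBlock, of_apply, Fintype.sum_sigma, blockDiagonal'_apply_eq, hsnoc,
      ← Finset.mul_sum, ← Finset.sum_mul, ht]
    have : (m : ℂ) + 1 ≠ 0 := by exact_mod_cast Nat.succ_ne_zero m
    simp [this]
  have h := entropy_refBlock_sub (fun k => posSemidef_tensorPow hρ.1 k) hc
  rw [entropy_tensorPow hρ, entropy_tensorPow hρ] at h
  have hm : (m : ℝ) + 1 ≠ 0 := by positivity
  have h' : 1 / ((m : ℝ) + 1) * (((m + 1 : ℕ) : ℝ) * entropy ρ - ((0 : ℕ) : ℝ) * entropy ρ)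
      = entropy ρ := by
    push_cast; field_simp; ring
  rw [mutualInfo, hR, trLeft_refBlock hc]
  linarith

end Blocks

/-! ### Distributed test channels are channels. -/

section Channel

variable {r a b x : Type*} [Fintype r] [Fintype a] [Fintype b] [Fintype x]
  [DecidableEq r] [DecidableEq a] [DecidableEq b] [DecidableEq x] {m w₁ w₂ : ℕ}

lemma measured_eq_localContract {a b a' b' κ : Type*} [Fintype a] [Fintype b] [Fintype a']
    [Fintype b'] (Λ : Matrix (a × a') (a × a') ℂ) (Λ' : Matrix (b × b') (b × b') ℂ)
    (ω : Matrix (a × b) (a × b) ℂ) (E : Matrix (a' × b' × κ) (a' × b' × κ) ℂ) :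
    measured Λ Λ' ω E = localContract Λ Λ' (of fun i i' =>
      ω (i.1.1, i.2.1.1) (i'.1.1, i'.2.1.1) * E (i.1.2, i.2.1.2, i.2.2) (i'.1.2, i'.2.1.2, i'.2.2)) := by
  ext; simp only [measured, localContract, of_apply, mul_assoc]

lemma measured_add {a b a' b' κ : Type*} [Fintype a] [Fintype b] [Fintype a']
    [Fintype b'] (Λ : Matrix (a × a') (a × a') ℂ) (Λ' : Matrix (b × b') (b × b') ℂ)
    (ω ω' : Matrix (a × b) (a × b) ℂ) (E : Matrix (a' × b' × κ) (a' × b' × κ) ℂ) :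
    measured Λ Λ' (ω + ω') E = measured Λ Λ' ω E + measured Λ Λ' ω' E := by
  ext; simp only [measured, of_apply, Matrix.add_apply, mul_add, add_mul, Finset.sum_add_distrib]

lemma measured_smul {a b a' b' κ : Type*} [Fintype a] [Fintype b] [Fintype a']
    [Fintype b'] (Λ : Matrix (a × a') (a × a') ℂ) (Λ' : Matrix (b × b') (b × b') ℂ)
    (c : ℂ) (ω : Matrix (a × b) (a × b) ℂ) (E : Matrix (a' × b' × κ) (a' × b' × κ) ℂ) :
    measured Λ Λ' (c • ω) E = c • measured Λ Λ' ω E := by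
  ext
  simp only [measured, of_apply, Matrix.smul_apply, smul_eq_mul, Finset.mul_sum]
  refine Finset.sum_congr rfl fun _ _ => Finset.sum_congr rfl fun _ _ =>
    Finset.sum_congr rfl fun _ _ => Finset.sum_congr rfl fun _ _ => ?_
  ring

/-- The distributed test channel with shared states `E`, measurements `ΛA`, `ΛB` and
reconstructions `S`. -/
noncomputable def distributedMap
    (E : ∀ j : Fin (m + 1), Matrix ((Fin m → a) × (Fin m → b) × (Fin (j : ℕ) → r))
        ((Fin m → a) × (Fin m → b) × (Fin (j : ℕ) → r)) ℂ)
    (ΛA : Fin (m + 1) → Fin w₁ → Matrix (a × (Fin m → a)) (a × (Fin m → a)) ℂ)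
    (ΛB : Fin (m + 1) → Fin w₂ → Matrix (b × (Fin m → b)) (b × (Fin m → b)) ℂ)
    (S : Fin (m + 1) → Fin w₁ → Fin w₂ → Matrix x x ℂ) :
    Matrix (a × b) (a × b) ℂ →ₗ[ℂ]
      Matrix (Fin w₁ × Fin w₂ × Fock r (m + 1) × x) (Fin w₁ × Fin w₂ × Fock r (m + 1) × x) ℂ where
  toFun ω := Matrix.of fun i i' =>
    if i.1 = i'.1 ∧ i.2.1 = i'.2.1 then
      Matrix.blockDiagonal' (fun j : Fin (m + 1) =>
        (1 / ((m : ℂ) + 1) * S j i.1 i.2.1 i.2.2.2 i'.2.2.2) •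
          measured (ΛA j i.1) (ΛB j i.2.1) ω (E j)) i.2.2.1 i'.2.2.1
    else 0
  map_add' ω ω' := by
    ext ⟨u, v, ⟨j, f⟩, k⟩ ⟨u', v', ⟨j', f'⟩, k'⟩
    simp only [of_apply, Matrix.add_apply]
    by_cases h : j = j'
    · subst h
      simp only [blockDiagonal'_apply_eq, measured_add, smul_add, Matrix.add_apply]
      split_ifs <;> simp
    · simp [blockDiagonal'_apply_ne _ _ _ h]
  map_smul' c ω := by
    ext ⟨u, v, ⟨j, f⟩, k⟩ ⟨u', v', ⟨j', f'⟩, k'⟩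
    simp only [of_apply, Matrix.smul_apply]
    by_cases h : j = j'
    · subst h
      simp only [blockDiagonal'_apply_eq, measured_smul, Matrix.smul_apply, smul_eq_mul,
        RingHom.id_apply]
      split_ifs
      · ring
      · simp
    · simp [blockDiagonal'_apply_ne _ _ _ h]

lemma trace_measured {a b a' b' κ u v : Type*} [Fintype a] [Fintype b] [Fintype a']
    [Fintype b'] [Fintype κ] [Fintype u] [Fintype v] [DecidableEq a] [DecidableEq b]
    [DecidableEq a'] [DecidableEq b'] {Λ : u → Matrix (a × a') (a × a') ℂ}
    {Λ' : v → Matrix (b × b') (b × b') ℂ} (hΛ : IsPOVM Λ) (hΛ' : IsPOVM Λ')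
    (ω : Matrix (a × b) (a × b) ℂ) (E : Matrix (a' × b' × κ) (a' × b' × κ) ℂ) :
    ∑ i, ∑ j, (measured (Λ i) (Λ' j) ω E).trace = ω.trace * E.trace := by
  simp only [measured_eq_localContract, ← Matrix.trace_sum, localContract_sum, hΛ.2, hΛ'.2]
  simp only [Matrix.trace, diag_apply, localContract_one, of_apply, Fintype.sum_prod_type]
  have h : ∀ k, ∑ y, ∑ p, ∑ z, ∑ q, ω (y, z) (y, z) * E (p, q, k) (p, q, k) =
      (∑ y, ∑ z, ω (y, z) (y, z)) * ∑ p, ∑ q, E (p, q, k) (p, q, k) := by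
    intro k
    rw [Finset.sum_mul]
    refine Finset.sum_congr rfl fun y _ => ?_
    rw [Finset.sum_mul, Finset.sum_comm]
    simp only [Finset.mul_sum]
  simp only [h]
  rw [← Finset.mul_sum]
  congr 1
  rw [Finset.sum_comm]
  exact Finset.sum_congr rfl fun p _ => by rw [Finset.sum_comm]

lemma isChannel_distributedMap
    {E : ∀ j : Fin (m + 1), Matrix ((Fin m → a) × (Fin m → b) × (Fin (j : ℕ) → r))
        ((Fin m → a) × (Fin m → b) × (Fin (j : ℕ) → r)) ℂ}
    {ΛA : Fin (m + 1) → Fin w₁ → Matrix (a × (Fin m → a)) (a × (Fin m → a)) ℂ}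
    {ΛB : Fin (m + 1) → Fin w₂ → Matrix (b × (Fin m → b)) (b × (Fin m → b)) ℂ}
    {S : Fin (m + 1) → Fin w₁ → Fin w₂ → Matrix x x ℂ}
    (hE : ∀ j, IsDensity (E j)) (hA : ∀ j, IsPOVM (ΛA j)) (hB : ∀ j, IsPOVM (ΛB j))
    (hS : ∀ j u v, IsDensity (S j u v)) : IsChannel (distributedMap E ΛA ΛB S) := by
  constructor
  · intro k M hM
    let Y : ∀ j : Fin (m + 1), Matrix ((a × (Fin m → a)) × (b × (Fin m → b)) ×
        (Fin k × (Fin (j : ℕ) → r))) ((a × (Fin m → a)) × (b × (Fin m → b)) ×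
        (Fin k × (Fin (j : ℕ) → r))) ℂ := fun j => (M ⊗ₖ E j).submatrix
      (fun i => ((i.2.2.1, i.1.1, i.2.1.1), (i.1.2, i.2.1.2, i.2.2.2)))
      (fun i => ((i.2.2.1, i.1.1, i.2.1.1), (i.1.2, i.2.1.2, i.2.2.2)))
    -- Complete positivity: for each classical label `(j, u, v)` the amplified output is a
    -- contraction of `M ⊗ E j` tensored with a reconstruction state. The whole output is the direct
    -- sum of these over the labels, reindexed.
    let Z : ∀ l : Fin (m + 1) × Fin w₁ × Fin w₂, Matrix ((Fin k × (Fin (l.1 : ℕ) → r)) × x)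
        ((Fin k × (Fin (l.1 : ℕ) → r)) × x) ℂ := fun l =>
      (1 / ((m : ℂ) + 1)) • (localContract (ΛA l.1 l.2.1) (ΛB l.1 l.2.2) (Y l.1) ⊗ₖ
        S l.1 l.2.1 l.2.2)
    have hZ : ∀ l, (Z l).PosSemidef := fun l => by
      refine PosSemidef.smul (PosSemidef.kronecker (posSemidef_localContract ((hA _).1 _)
        ((hB _).1 _) ?_) (hS _ _ _).1) ?_
      · exact (hM.kronecker (hE _).1).submatrix _
      · rw [one_div_cast, Complex.zero_le_real]; positivity
    have h : ampl (Fin k) (distributedMap E ΛA ΛB S) M = (blockDiagonal' Z).submatrix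
        (fun i => ⟨(i.2.2.2.1.1, i.2.1, i.2.2.1), ((i.1, i.2.2.2.1.2), i.2.2.2.2)⟩)
        (fun i => ⟨(i.2.2.2.1.1, i.2.1, i.2.2.1), ((i.1, i.2.2.2.1.2), i.2.2.2.2)⟩) := by
      ext ⟨l, u, v, ⟨j, f⟩, y⟩ ⟨l', u', v', ⟨j', f'⟩, y'⟩
      simp only [ampl, distributedMap, LinearMap.coe_mk, AddHom.coe_mk, of_apply, submatrix_apply]
      by_cases hj : (j, u, v) = (j', u', v')
      · obtain ⟨rfl, rfl, rfl⟩ : j = j' ∧ u = u' ∧ v = v' := by simpa using hj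
        simp only [and_self, if_true, blockDiagonal'_apply_eq, Z, Matrix.smul_apply, smul_eq_mul,
          kroneckerMap_apply, measured, localContract, of_apply, Y, submatrix_apply]
        simp only [mul_assoc]
        rw [mul_comm (S j u v y y')]
      · rw [blockDiagonal'_apply_ne _ _ _ hj]
        by_cases hj' : j = j'
        · rw [if_neg]
          rintro ⟨rfl, rfl⟩
          exact hj (by rw [hj'])
        · simp [blockDiagonal'_apply_ne _ _ _ hj']
    rw [h]
    exact (posSemidef_blockDiagonal' hZ).submatrix _
  · intro ω
    have h1 : (distributedMap E ΛA ΛB S ω).trace = ∑ j : Fin (m + 1), 1 / ((m : ℂ) + 1) *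
        ∑ u, ∑ v, (measured (ΛA j u) (ΛB j v) ω (E j)).trace := by
      have h2 : ∀ j u v, ∑ y, S j u v y y = 1 := fun j u v => (hS j u v).2
      simp only [Matrix.trace, diag_apply, distributedMap, LinearMap.coe_mk, AddHom.coe_mk,
        of_apply, Fintype.sum_prod_type, Fintype.sum_sigma, and_self, if_true,
        blockDiagonal'_apply_eq, Matrix.smul_apply, smul_eq_mul]
      simp only [← Finset.sum_mul, ← Finset.mul_sum, h2, mul_one]
      simp only [Finset.mul_sum]
      symm
      rw [Finset.sum_comm]
      exact Finset.sum_congr rfl fun u _ => Finset.sum_comm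
    rw [h1]
    simp only [trace_measured (hA _) (hB _), (hE _).2, mul_one]
    have : (m : ℂ) + 1 ≠ 0 := by exact_mod_cast Nat.succ_ne_zero m
    simp [this]

end Channel

/-! ### The test channel of a protocol and its information quantities. -/

section Outer

variable {r a b x : Type*} [Fintype r] [Fintype a] [Fintype b] [Fintype x]
  [DecidableEq r] [DecidableEq a] [DecidableEq b] [DecidableEq x] {m w₁ w₂ : ℕ}

/-- The marginal of a state of `X^{m+1}` at site `j`. -/
def siteMarginal (j : Fin (m + 1)) (S : Matrix (Fin (m + 1) → x) (Fin (m + 1) → x) ℂ) :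
    Matrix x x ℂ :=
  of fun k k' => ∑ g, S (j.insertNth k g) (j.insertNth k' g)

lemma isDensity_siteMarginal (j : Fin (m + 1))
    {S : Matrix (Fin (m + 1) → x) (Fin (m + 1) → x) ℂ} (hS : IsDensity S) :
    IsDensity (siteMarginal j S) := by
  have h : siteMarginal j S = trRight (S.submatrix (Fin.insertNthEquiv (fun _ => x) j)
      (Fin.insertNthEquiv (fun _ => x) j)) := by
    ext; simp [siteMarginal, trRight, Fin.insertNthEquiv]
  rw [h]
  refine ⟨posSemidef_trRight (hS.1.submatrix _), ?_⟩
  rw [trace_trRight, Matrix.trace]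
  simp only [diag_apply, submatrix_apply]
  rw [(Fin.insertNthEquiv (fun _ => x) j).sum_comp fun i => S i i]
  exact hS.2

/-- The measurement `Λ` of `n = m + 1` systems, regrouped as a measurement of system `j` and the
remaining ones. -/
def splitAt (j : Fin (m + 1)) (Λ : Matrix (Fin (m + 1) → a) (Fin (m + 1) → a) ℂ) :
    Matrix (a × (Fin m → a)) (a × (Fin m → a)) ℂ :=
  Λ.submatrix (Fin.insertNthEquiv (fun _ => a) j) (Fin.insertNthEquiv (fun _ => a) j)

lemma isPOVM_splitAt {κ : Type*} [Fintype κ] (j : Fin (m + 1))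
    {Λ : κ → Matrix (Fin (m + 1) → a) (Fin (m + 1) → a) ℂ} (hΛ : IsPOVM Λ) :
    IsPOVM fun u => splitAt j (Λ u) := by
  refine ⟨fun u => (hΛ.1 u).submatrix _, ?_⟩
  have h : ∑ u, splitAt j (Λ u) = splitAt j (∑ u, Λ u) := by
    ext; simp [splitAt, Matrix.sum_apply]
  rw [h, hΛ.2, splitAt, submatrix_one_equiv]

/-- The single-letter test channel of a protocol with `m + 1` letters. -/
noncomputable def Setup.testChannel (s : Setup r a b x) (P : Protocol a b x (m + 1) w₁ w₂) :
    Matrix (a × b) (a × b) ℂ →ₗ[ℂ]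
      Matrix (Fin w₁ × Fin w₂ × Fock r (m + 1) × x) (Fin w₁ × Fin w₂ × Fock r (m + 1) × x) ℂ :=
  distributedMap (fun j => s.partialPow m j) (fun j u => splitAt j (P.ΛA u))
    (fun j v => splitAt j (P.ΛB v)) (fun j u v => siteMarginal j (P.S u v))

lemma Setup.isChannel_testChannel (s : Setup r a b x) (P : Protocol a b x (m + 1) w₁ w₂) :
    IsChannel (s.testChannel P) :=
  isChannel_distributedMap (fun j => s.isDensity_partialPow (Nat.lt_succ_iff.1 j.2))
    (fun j => isPOVM_splitAt j P.povmA) (fun j => isPOVM_splitAt j P.povmB)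
    (fun j u v => isDensity_siteMarginal j (P.densityS u v))

lemma Setup.isDistributed_testChannel (s : Setup r a b x) (P : Protocol a b x (m + 1) w₁ w₂) :
    IsDistributed (s.testChannel P) :=
  ⟨fun j => s.partialPow m j, fun j u => splitAt j (P.ΛA u), fun j v => splitAt j (P.ΛB v),
    fun j u v => siteMarginal j (P.S u v),
    fun j => s.isDensity_partialPow (Nat.lt_succ_iff.1 j.2),
    fun j => isPOVM_splitAt j P.povmA, fun j => isPOVM_splitAt j P.povmB,
    fun j u v => isDensity_siteMarginal j (P.densityS u v), fun _ => rfl⟩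

/-- The post-measurement states of `R^k` for the outcomes `u`, `v` of a protocol. -/
def Setup.outcome (s : Setup r a b x) {n : ℕ} (P : Protocol a b x n w₁ w₂) (u : Fin w₁)
    (v : Fin w₂) (k : ℕ) : Matrix (Fin k → r) (Fin k → r) ℂ :=
  s.post n k (P.ΛA u) (P.ΛB v)

lemma Setup.posSemidef_outcome (s : Setup r a b x) {n : ℕ} (P : Protocol a b x n w₁ w₂)
    (u : Fin w₁) (v : Fin w₂) (k : ℕ) : (s.outcome P u v k).PosSemidef :=
  s.posSemidef_post n k (P.povmA.1 u) (P.povmB.1 v)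

lemma Setup.consistent_outcome (s : Setup r a b x) (P : Protocol a b x (m + 1) w₁ w₂)
    (u : Fin w₁) (v : Fin w₂) : Consistent m (s.outcome P u v) := fun k hk f f' =>
  s.sum_post_snoc ⟨k, Nat.lt_succ_of_le hk⟩ (P.ΛA u) (P.ΛB v) f f'

lemma Setup.sum_outcome (s : Setup r a b x) {n : ℕ} (P : Protocol a b x n w₁ w₂) {k : ℕ}
    (hk : k ≤ n) : ∑ u, ∑ v, s.outcome P u v k = tensorPow (trRight s.Ψ) k :=
  s.sum_post hk P.povmA P.povmB

lemma Setup.sum_trace_outcome (s : Setup r a b x) {n : ℕ} (P : Protocol a b x n w₁ w₂) :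
    ∑ u, ∑ v, (s.outcome P u v 0).trace.re = 1 := by
  have h := congrArg (fun M => (Matrix.trace M).re) (s.sum_outcome P (Nat.zero_le n))
  simpa [Matrix.trace_sum, trace_tensorPow] using h

/-- Conditionally on `(j, u, v)` the reconstruction is in a product with `R` and `Q`, whose joint
state is supplied by `measured_partialPow`. All marginals are read off from this formula. -/
lemma Setup.ampl_testChannel (s : Setup r a b x) (P : Protocol a b x (m + 1) w₁ w₂)
    (w w' : r) (u u' : Fin w₁) (v v' : Fin w₂) (j j' : Fin (m + 1)) (f : Fin (j : ℕ) → r)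
    (f' : Fin (j' : ℕ) → r) (k k' : x) :
    ampl r (s.testChannel P) s.Ψ (w, u, v, ⟨j, f⟩, k) (w', u', v', ⟨j', f'⟩, k') =
      siteMarginal j (P.S u v) k k' * if u = u' ∧ v = v' then
        refBlock m (s.outcome P u v) (w, ⟨j, f⟩) (w', ⟨j', f'⟩) else 0 := by
  simp only [ampl, Setup.testChannel, distributedMap, LinearMap.coe_mk, AddHom.coe_mk, of_apply,
    refBlock]
  by_cases h : j = j'
  · subst h
    simp only [blockDiagonal'_apply_eq, Matrix.smul_apply, smul_eq_mul, splitAt,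
      s.measured_partialPow, of_apply, Setup.outcome]
    split_ifs
    · ring
    · simp
  · simp [blockDiagonal'_apply_ne _ _ _ h]

/-- Tracing out the reconstruction leaves a state that is classical on both outcomes. -/
lemma Setup.sum_ampl_testChannel (s : Setup r a b x) (P : Protocol a b x (m + 1) w₁ w₂)
    (w w' : r) (u u' : Fin w₁) (v v' : Fin w₂) (q q' : Fock r (m + 1)) :
    ∑ k, ampl r (s.testChannel P) s.Ψ (w, u, v, q, k) (w', u', v', q', k) =
      if u = u' ∧ v = v' then refBlock m (s.outcome P u v) (w, q) (w', q') else 0 := by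
  obtain ⟨j, f⟩ := q
  obtain ⟨j', f'⟩ := q'
  simp only [s.ampl_testChannel, ← Finset.sum_mul]
  have h : ∑ k, siteMarginal j (P.S u v) k k = 1 :=
    (isDensity_siteMarginal j (P.densityS u v)).2
  rw [h, one_mul]

lemma Setup.mutualInfo_testChannel (s : Setup r a b x) (P : Protocol a b x (m + 1) w₁ w₂) :
    mutualInfo (trLeft (of fun i i' : (Fin w₁ × Fin w₂) × r × Fock r (m + 1) =>
      ∑ k, ampl r (s.testChannel P) s.Ψ (i.2.1, i.1.1, i.1.2, i.2.2, k)
        (i'.2.1, i'.1.1, i'.1.2, i'.2.2, k))) = 0 := by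
  rw [← mutualInfo_refBlock_tensorPow m s.isDensity_reference]
  congr 1
  have h : refBlock m (tensorPow (trRight s.Ψ)) = refBlock m (∑ u, ∑ v, s.outcome P u v) := by
    ext ⟨w, j, f⟩ ⟨w', j', f'⟩
    simp only [refBlock, of_apply]
    by_cases h : j = j'
    · subst h
      simp only [blockDiagonal'_apply_eq, of_apply, sum_family_apply,
        s.sum_outcome P (Nat.succ_le_of_lt j.2)]
    · simp only [blockDiagonal'_apply_ne _ _ _ h]
  rw [h]
  simp only [← refBlock_sum]
  ext i i'
  simp only [trLeft, of_apply, s.sum_ampl_testChannel, and_self, if_true, Matrix.sum_apply,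
    Fintype.sum_prod_type]

/-- For each fixed `v`, `classical_information_le` bounds the contribution by the probability of `v`
times `log₂ w₁ / (m + 1)`. These probabilities sum to one. -/
lemma Setup.condMutualInfo_testChannel_left (s : Setup r a b x)
    (P : Protocol a b x (m + 1) w₁ w₂) :
    condMutualInfo (of fun i i' : Fin w₁ × r × Fin w₂ × Fock r (m + 1) =>
      ∑ k, ampl r (s.testChannel P) s.Ψ (i.2.1, i.1, i.2.2.1, i.2.2.2, k)
        (i'.2.1, i'.1, i'.2.2.1, i'.2.2.2, k)) ≤ 1 / ((m + 1 : ℕ) : ℝ) * Real.logb 2 w₁ := by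
  simp only [s.sum_ampl_testChannel]
  rw [condMutualInfo_classical₂ (d := fun u v => refBlock m (s.outcome P u v))
    fun u v => posSemidef_refBlock (s.posSemidef_outcome P u v)]
  refine (Finset.sum_le_sum fun v _ => classical_information_le
    (fun u k => s.posSemidef_outcome P u v k) fun u => s.consistent_outcome P u v).trans
    (le_of_eq ?_)
  rw [← Finset.mul_sum, ← Finset.sum_mul, Finset.sum_comm, s.sum_trace_outcome]
  simp

lemma Setup.condMutualInfo_testChannel_right (s : Setup r a b x)
    (P : Protocol a b x (m + 1) w₁ w₂) :
    condMutualInfo (of fun i i' : Fin w₂ × r × Fin w₁ × Fock r (m + 1) =>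
      ∑ k, ampl r (s.testChannel P) s.Ψ (i.2.1, i.2.2.1, i.1, i.2.2.2, k)
        (i'.2.1, i'.2.2.1, i'.1, i'.2.2.2, k)) ≤ 1 / ((m + 1 : ℕ) : ℝ) * Real.logb 2 w₂ := by
  simp only [s.sum_ampl_testChannel]
  have h := condMutualInfo_classical₂ (d := fun v u => refBlock m (s.outcome P u v))
    fun v u => posSemidef_refBlock (s.posSemidef_outcome P u v)
  simp only [and_comm (a := _ = (_ : Fin w₂))] at h
  rw [h]
  refine (Finset.sum_le_sum fun u _ => classical_information_le
    (fun v k => s.posSemidef_outcome P u v k) fun v => s.consistent_outcome P u v).trans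
    (le_of_eq ?_)
  rw [← Finset.mul_sum, ← Finset.sum_mul, s.sum_trace_outcome]
  simp

lemma Setup.condMutualInfo_testChannel_both (s : Setup r a b x)
    (P : Protocol a b x (m + 1) w₁ w₂) :
    condMutualInfo (of fun i i' : (Fin w₁ × Fin w₂) × r × Fock r (m + 1) =>
      ∑ k, ampl r (s.testChannel P) s.Ψ (i.2.1, i.1.1, i.1.2, i.2.2, k)
        (i'.2.1, i'.1.1, i'.1.2, i'.2.2, k)) ≤
      1 / ((m + 1 : ℕ) : ℝ) * Real.logb 2 (w₁ * w₂) := by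
  simp only [s.sum_ampl_testChannel]
  have h := condMutualInfo_classical (d := fun p : Fin w₁ × Fin w₂ =>
    refBlock m (s.outcome P p.1 p.2)) fun p => posSemidef_refBlock (s.posSemidef_outcome P p.1 p.2)
  simp only [Prod.ext_iff (α := Fin w₁)] at h
  rw [h]
  refine (classical_information_le (T := fun p : Fin w₁ × Fin w₂ => s.outcome P p.1 p.2)
    (fun p k => s.posSemidef_outcome P p.1 p.2 k) fun p => s.consistent_outcome P p.1 p.2).trans
    (le_of_eq ?_)
  rw [Fintype.sum_prod_type, s.sum_trace_outcome]
  simp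

end Outer

/-! ### The test channel has the distortion of the protocol. -/

section Distortion

variable {r a b x : Type*} [Fintype r] [Fintype a] [Fintype b] [Fintype x]
  [DecidableEq r] [DecidableEq a] [DecidableEq b] [DecidableEq x] {m w₁ w₂ : ℕ}

/-- The marginal of an operator on `R^{m+1} ⊗ X^{m+1}` at site `j`. -/
def pairMarginal (j : Fin (m + 1))
    (M : Matrix ((Fin (m + 1) → r) × (Fin (m + 1) → x)) ((Fin (m + 1) → r) × (Fin (m + 1) → x)) ℂ) :
    Matrix (r × x) (r × x) ℂ :=
  of fun i i' => ∑ g, ∑ h, M (j.insertNth i.1 g, j.insertNth i.2 h)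
    (j.insertNth i'.1 g, j.insertNth i'.2 h)

lemma prod_erase_eq {M : Type*} [CommMonoid M] (j : Fin (m + 1)) (g : Fin (m + 1) → M) :
    ∏ t ∈ Finset.univ.erase j, g t = ∏ i, g (j.succAbove i) := by
  have h : Finset.univ.erase j = Finset.univ.map (Fin.succAboveEmb j) := by
    rw [Fin.univ_succAbove m j, Finset.erase_cons]
  rw [h, Finset.prod_map]
  rfl

lemma prod_erase_one_apply (j : Fin (m + 1)) (F F' : Fin (m + 1) → r) (X X' : Fin (m + 1) → x) :
    ∏ t ∈ Finset.univ.erase j, (1 : Matrix (r × x) (r × x) ℂ) (F t, X t) (F' t, X' t) =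
      if j.removeNth F = j.removeNth F' ∧ j.removeNth X = j.removeNth X' then 1 else 0 := by
  rw [prod_erase_eq]
  simp only [Matrix.one_apply]
  rw [Finset.prod_ite_zero]
  simp [funext_iff, Fin.removeNth, forall_and]

lemma sum_pair_comm {α β γ δ : Type*} [Fintype α] [Fintype β] [Fintype γ] [Fintype δ]
    (f : α → β → γ → δ → ℂ) :
    ∑ i, ∑ j, ∑ k, ∑ l, f i j k l = ∑ k, ∑ l, ∑ i, ∑ j, f i j k l := by
  have h : ∑ p : α × β, ∑ q : γ × δ, f p.1 p.2 q.1 q.2 =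
      ∑ q : γ × δ, ∑ p : α × β, f p.1 p.2 q.1 q.2 := Finset.sum_comm
  simpa only [Fintype.sum_prod_type] using h

lemma sum_insertNth {α : Type*} [Fintype α] (j : Fin (m + 1)) (F : (Fin (m + 1) → α) → ℂ) :
    ∑ f, F f = ∑ y, ∑ g, F (j.insertNth y g) := by
  rw [← (Fin.insertNthEquiv (fun _ => α) j).sum_comp, Fintype.sum_prod_type]
  rfl

/-- The average distortion is the average of the distortions of the site marginals. -/
lemma Setup.trace_Δavg_mul (s : Setup r a b x)
    (M : Matrix ((Fin (m + 1) → r) × (Fin (m + 1) → x)) ((Fin (m + 1) → r) × (Fin (m + 1) → x)) ℂ) :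
    (s.Δavg (m + 1) * M).trace = 1 / ((m : ℂ) + 1) * ∑ j, (s.Δ * pairMarginal j M).trace := by
  have h : ∀ j : Fin (m + 1), ∑ F, ∑ X, ∑ F', ∑ X', (s.Δ (F j, X j) (F' j, X' j) *
      ∏ t' ∈ Finset.univ.erase j, (1 : Matrix (r × x) (r × x) ℂ) (F t', X t') (F' t', X' t')) *
        M (F', X') (F, X) = (s.Δ * pairMarginal j M).trace := by
    intro j
    simp only [prod_erase_one_apply, sum_insertNth j, Fin.insertNth_apply_same,
      Fin.removeNth_insertNth, ite_and, mul_ite, ite_mul, mul_zero, zero_mul, mul_one,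
      Finset.sum_ite_irrel, Finset.sum_const_zero, Finset.sum_ite_eq, Finset.mem_univ, if_true]
    simp only [Matrix.trace, diag_apply, Matrix.mul_apply, pairMarginal, of_apply,
      Fintype.sum_prod_type, Finset.mul_sum]
    refine Finset.sum_congr rfl fun w _ => ?_
    rw [Finset.sum_comm]
    exact Finset.sum_congr rfl fun k _ => sum_pair_comm _
  simp only [Matrix.trace, diag_apply, Matrix.mul_apply, Setup.Δavg, of_apply,
    Fintype.sum_prod_type] at h ⊢
  simp only [← h, Finset.mul_sum, Finset.sum_mul]
  symm
  rw [Finset.sum_comm]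
  refine Finset.sum_congr rfl fun F _ => ?_
  rw [Finset.sum_comm]
  refine Finset.sum_congr rfl fun X _ => ?_
  rw [Finset.sum_comm]
  refine Finset.sum_congr rfl fun F' _ => ?_
  rw [Finset.sum_comm]
  refine Finset.sum_congr rfl fun X' _ => Finset.sum_congr rfl fun j _ => ?_
  push_cast
  ring

lemma Setup.Ψpow_eq (s : Setup r a b x) (n : ℕ) (F F' : Fin n → r) (p p' : Fin n → a)
    (q q' : Fin n → b) :
    s.Ψpow n (F, p, q) (F', p', q') = s.partialPow n n (p, q, F) (p', q', F') := by
  simp [Setup.Ψpow, Setup.partialPow]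

lemma Setup.ampl_action (s : Setup r a b x) {n : ℕ} (P : Protocol a b x n w₁ w₂)
    (F F' : Fin n → r) (X X' : Fin n → x) :
    ampl (Fin n → r) P.action (s.Ψpow n) (F, X) (F', X') =
      ∑ u, ∑ v, s.outcome P u v n F F' * P.S u v X X' := by
  simp only [ampl, Protocol.action, of_apply, Matrix.sum_apply, Matrix.smul_apply, smul_eq_mul]
  refine Finset.sum_congr rfl fun u _ => Finset.sum_congr rfl fun v _ => ?_
  congr 1
  simp only [Matrix.trace, diag_apply, Matrix.mul_apply, kroneckerMap_apply, of_apply, s.Ψpow_eq,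
    Fintype.sum_prod_type, Setup.outcome, Setup.post, localContract]
  rw [sum_pair_comm]
  exact Finset.sum_congr rfl fun _ _ => Finset.sum_comm

/-- Tracing out the kept references leaves the source power whatever `k` was. This lets the final
state be compared with the state after `j + 1` references. -/
lemma Setup.sum_partialPow_left (s : Setup r a b x) {m k : ℕ} (hk : k ≤ m) (p p' : Fin m → a)
    (q q' : Fin m → b) :
    ∑ f, s.partialPow m k (p, q, f) (p', q', f) = ∏ t, trLeft s.Ψ (p t, q t) (p' t, q' t) := by
  simp only [Setup.partialPow, of_apply]
  have h := fun f : Fin k → r => prod_dite_lt hk (fun t => s.Ψ (f t, p (t.castLE hk), q (t.castLE hk))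
    (f t, p' (t.castLE hk), q' (t.castLE hk))) fun t => trLeft s.Ψ (p t, q t) (p' t, q' t)
  have h' := prod_dite_lt hk (fun t => trLeft s.Ψ (p (t.castLE hk), q (t.castLE hk))
    (p' (t.castLE hk), q' (t.castLE hk))) fun t => trLeft s.Ψ (p t, q t) (p' t, q' t)
  simp only [Fin.castLE_mk, Fin.eta, dite_eq_ite, ite_self] at h h'
  rw [h', Finset.sum_congr rfl fun f _ => h f, ← Finset.sum_mul]
  congr 1
  simp only [trLeft, of_apply]
  rw [Finset.prod_univ_sum, Fintype.piFinset_univ]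

/-- The single-site marginal of the final state agrees with the marginal of the state of the
first `j + 1` systems on the last one. -/
lemma Setup.sum_post_insertNth (s : Setup r a b x) (j : Fin (m + 1))
    (Λ : Matrix (Fin (m + 1) → a) (Fin (m + 1) → a) ℂ)
    (Λ' : Matrix (Fin (m + 1) → b) (Fin (m + 1) → b) ℂ) (w w' : r) :
    ∑ g, s.post (m + 1) (m + 1) Λ Λ' (j.insertNth w g) (j.insertNth w' g) =
      ∑ f, s.post (m + 1) (j + 1) Λ Λ' (Fin.snoc f w) (Fin.snoc f w') := by
  -- Both sides equal `ψ` at site `j` times the source state at the other sites, whose references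
  -- are all traced out.
  have h1 : ∀ p p' q q', ∑ g, s.partialPow (m + 1) (m + 1) (p, q, j.insertNth w g)
      (p', q', j.insertNth w' g) = ∑ f, s.partialPow (m + 1) (j + 1) (p, q, Fin.snoc f w)
        (p', q', Fin.snoc f w') := by
    intro p p' q q'
    rw [← Fin.insertNth_self_removeNth j p, ← Fin.insertNth_self_removeNth j p',
      ← Fin.insertNth_self_removeNth j q, ← Fin.insertNth_self_removeNth j q']
    have h2 : ∀ (y y' : a) (z z' : b) (p p' : Fin m → a) (q q' : Fin m → b) (g : Fin m → r),
        s.partialPow (m + 1) (m + 1) (j.insertNth y p, j.insertNth z q, j.insertNth w g)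
          (j.insertNth y' p', j.insertNth z' q', j.insertNth w' g) =
        s.Ψ (w, y, z) (w', y', z') * s.partialPow m m (p, q, g) (p', q', g) := by
      intro y y' z z' p p' q q' g
      simp only [← s.Ψpow_eq, Setup.Ψpow, of_apply]
      rw [Fin.prod_univ_succAbove _ j]
      simp
    simp only [h2, s.partialPow_succ, ← Finset.mul_sum, s.sum_partialPow_left le_rfl,
      s.sum_partialPow_left (Nat.lt_succ_iff.1 j.2)]
  simp only [Setup.post, localContract, of_apply]
  rw [Finset.sum_comm, Finset.sum_comm (s := (Finset.univ : Finset (Fin (j : ℕ) → r)))]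
  refine Finset.sum_congr rfl fun _ _ => ?_
  rw [Finset.sum_comm, Finset.sum_comm (s := (Finset.univ : Finset (Fin (j : ℕ) → r)))]
  refine Finset.sum_congr rfl fun _ _ => ?_
  rw [Finset.sum_comm, Finset.sum_comm (s := (Finset.univ : Finset (Fin (j : ℕ) → r)))]
  refine Finset.sum_congr rfl fun _ _ => ?_
  rw [Finset.sum_comm, Finset.sum_comm (s := (Finset.univ : Finset (Fin (j : ℕ) → r)))]
  refine Finset.sum_congr rfl fun _ _ => ?_
  rw [← Finset.mul_sum, ← Finset.mul_sum, h1]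

/-- Given `j`, the pair `R`, `X` is in the site-`j` marginal of the protocol's final state, and the
uniform `j` averages these marginals just as `Δavg` does. -/
lemma Setup.distortion_testChannel (s : Setup r a b x) (P : Protocol a b x (m + 1) w₁ w₂) :
    (s.Δ * of fun i i' : r × x => ∑ u, ∑ v, ∑ q, ampl r (s.testChannel P) s.Ψ
      (i.1, u, v, q, i.2) (i'.1, u, v, q, i'.2)).trace.re = s.distortion P := by
  have h : (of fun i i' : r × x => ∑ u, ∑ v, ∑ q, ampl r (s.testChannel P) s.Ψ
      (i.1, u, v, q, i.2) (i'.1, u, v, q, i'.2)) = (1 / ((m : ℂ) + 1)) •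
        ∑ j, pairMarginal j (ampl (Fin (m + 1) → r) P.action (s.Ψpow (m + 1))) := by
    ext ⟨w, k⟩ ⟨w', k'⟩
    simp only [of_apply, Fintype.sum_sigma, s.ampl_testChannel, and_self, if_true, refBlock,
      blockDiagonal'_apply_eq, Matrix.smul_apply, Matrix.sum_apply, pairMarginal, s.ampl_action,
      smul_eq_mul]
    have h1 : ∀ j : Fin (m + 1), ∑ g, ∑ h, ∑ u, ∑ v, s.outcome P u v (m + 1) (j.insertNth w g)
        (j.insertNth w' g) * P.S u v (j.insertNth k h) (j.insertNth k' h) =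
        ∑ u, ∑ v, (∑ f, s.outcome P u v (j + 1) (Fin.snoc f w) (Fin.snoc f w')) *
          siteMarginal j (P.S u v) k k' := by
      intro j
      simp only [Setup.outcome, ← s.sum_post_insertNth, siteMarginal, of_apply, Finset.sum_mul_sum]
      exact sum_pair_comm _
    simp only [h1, Finset.mul_sum, Finset.sum_mul]
    symm
    rw [Finset.sum_comm]
    refine Finset.sum_congr rfl fun u _ => ?_
    rw [Finset.sum_comm]
    refine Finset.sum_congr rfl fun v _ => Finset.sum_congr rfl fun j _ =>
      Finset.sum_congr rfl fun f _ => ?_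
    ring
  rw [h, Setup.distortion, s.trace_Δavg_mul, Matrix.mul_smul, Matrix.trace_smul, smul_eq_mul,
    Matrix.mul_sum, Matrix.trace_sum]

lemma Setup.outerBound_testChannel (s : Setup r a b x) (P : Protocol a b x (m + 1) w₁ w₂)
    {R₁ R₂ D : ℝ} (h₁ : 1 / ((m + 1 : ℕ) : ℝ) * Real.logb 2 w₁ ≤ R₁)
    (h₂ : 1 / ((m + 1 : ℕ) : ℝ) * Real.logb 2 w₂ ≤ R₂) (hw₁ : w₁ ≠ 0) (hw₂ : w₂ ≠ 0)
    (hD : s.distortion P ≤ D) : s.OuterBound (s.testChannel P) R₁ R₂ D := by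
  refine ⟨s.isChannel_testChannel P, s.mutualInfo_testChannel P,
    (s.condMutualInfo_testChannel_left P).trans h₁,
    (s.condMutualInfo_testChannel_right P).trans h₂,
    (s.condMutualInfo_testChannel_both P).trans ?_, (s.distortion_testChannel P).trans_le hD⟩
  rw [Real.logb_mul (by exact_mod_cast hw₁) (by exact_mod_cast hw₂), mul_add]
  exact add_le_add h₁ h₂

end Distortion

/-! ### Choi matrices and compactness of the set of channels. -/

section Choi

variable {α x : Type*} [Fintype α] [DecidableEq α] [Fintype x] [DecidableEq x]

lemma exists_eq_conjTranspose_mul {ρ : Matrix α α ℂ} (hρ : ρ.PosSemidef) :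
    ∃ B : Matrix α α ℂ, ρ = Bᴴ * B := by
  obtain ⟨U, -, -, hU⟩ := exists_unitary_diagonal hρ.1
  let d : α → ℂ := fun i => (Real.sqrt (hρ.1.eigenvalues i) : ℂ)
  have hd : (diagonal d)ᴴ * diagonal d = diagonal fun i => (hρ.1.eigenvalues i : ℂ) := by
    rw [diagonal_conjTranspose, diagonal_mul_diagonal]
    congr 1
    funext i
    simp only [d, Pi.star_apply, RCLike.star_def, Complex.conj_ofReal]
    rw [← Complex.ofReal_mul, Real.mul_self_sqrt (hρ.eigenvalues_nonneg i)]
  refine ⟨diagonal d * Uᴴ, ?_⟩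
  conv_lhs => rw [hU, ← hd]
  simp only [conjTranspose_mul, conjTranspose_conjTranspose, Matrix.mul_assoc]

/-- The map with Choi matrix `C`, with additional trivial output registers. -/
def choiMap (C : Matrix (α × x) (α × x) ℂ) :
    Matrix α α ℂ →ₗ[ℂ] Matrix (Fin 1 × Fin 1 × Fin 1 × x) (Fin 1 × Fin 1 × Fin 1 × x) ℂ where
  toFun ω := of fun i i' => ∑ s, ∑ s', ω s s' * C (s, i.2.2.2) (s', i'.2.2.2)
  map_add' ω ω' := by
    ext; simp only [of_apply, Matrix.add_apply, add_mul, Finset.sum_add_distrib]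
  map_smul' c ω := by
    ext; simp only [of_apply, Matrix.smul_apply, smul_eq_mul, mul_assoc, Finset.mul_sum,
      RingHom.id_apply]

lemma isChannel_choiMap {C : Matrix (α × x) (α × x) ℂ} (hC : C.PosSemidef)
    (hC' : ∀ s s', ∑ k, C (s, k) (s', k) = if s = s' then 1 else 0) : IsChannel (choiMap C) := by
  constructor
  · intro k M hM
    -- Both factors read the same index in `α`, so contracting with the all-ones matrix sums `M`
    -- against `C` over `s, s'`. `Unit` stands in for the absent second party.
    let Y : Matrix (α × Unit × (Fin k × Fin 1 × Fin 1 × Fin 1 × x))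
        (α × Unit × (Fin k × Fin 1 × Fin 1 × Fin 1 × x)) ℂ := (M ⊗ₖ C).submatrix
      (fun i => ((i.2.2.1, i.1), (i.1, i.2.2.2.2.2.2)))
      (fun i => ((i.2.2.1, i.1), (i.1, i.2.2.2.2.2.2)))
    have h : ampl (Fin k) (choiMap C) M =
        localContract (vecMulVec (fun _ => 1) (star fun _ => 1)) 1 Y := by
      ext i i'
      simp [ampl, choiMap, localContract, Y, vecMulVec_apply]
    rw [h]
    exact posSemidef_localContract (posSemidef_vecMulVec_self_star _) PosSemidef.one
      ((hM.kronecker hC).submatrix _)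
  · intro ω
    have h : (choiMap C ω).trace = ∑ s, ∑ s', ω s s' * ∑ k, C (s, k) (s', k) := by
      simp only [Matrix.trace, diag_apply, choiMap, LinearMap.coe_mk, AddHom.coe_mk, of_apply,
        Fintype.sum_prod_type, Finset.univ_unique, Finset.sum_singleton, Finset.mul_sum]
      rw [Finset.sum_comm]
      exact Finset.sum_congr rfl fun s _ => Finset.sum_comm
    rw [h]
    simp [hC', Matrix.trace]

/-- The Choi matrix of a map after discarding the registers `W₁`, `W₂`, `Q`. -/
def choi {w₁ w₂ q : Type*} [Fintype w₁] [Fintype w₂] [Fintype q]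
    (N : Matrix α α ℂ →ₗ[ℂ] Matrix (w₁ × w₂ × q × x) (w₁ × w₂ × q × x) ℂ) :
    Matrix (α × x) (α × x) ℂ :=
  of fun i i' => ∑ u, ∑ v, ∑ l, N (Matrix.single i.1 i'.1 1) (u, v, l, i.2) (u, v, l, i'.2)

lemma posSemidef_choi {w₁ w₂ q : Type*} [Fintype w₁] [Fintype w₂] [Fintype q]
    {N : Matrix α α ℂ →ₗ[ℂ] Matrix (w₁ × w₂ × q × x) (w₁ × w₂ × q × x) ℂ} (hN : IsChannel N) :
    (choi N).PosSemidef := by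
  let e := Fintype.equivFin α
  -- The unnormalised maximally entangled vector. Its ancilla is indexed by `Fin`, as `IsChannel`
  -- requires.
  let φ : Fin (Fintype.card α) × α → ℂ := fun i => if e i.2 = i.1 then 1 else 0
  have hM := hN.1 _ _ (posSemidef_vecMulVec_self_star φ)
  have h : choi N = ∑ u, ∑ v, ∑ l, (ampl (Fin (Fintype.card α)) N
      (vecMulVec φ (star φ))).submatrix (fun i : α × x => (e i.1, (u, v, l, i.2)))
        (fun i : α × x => (e i.1, (u, v, l, i.2))) := by
    ext ⟨s, k⟩ ⟨s', k'⟩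
    have hs : (of fun t t' => vecMulVec φ (star φ) (e s, t) (e s', t')) =
        (Matrix.single s s' 1 : Matrix α α ℂ) := by
      ext t t'
      simp only [of_apply, vecMulVec_apply, Pi.star_apply, φ, e.apply_eq_iff_eq, Matrix.single_apply,
        apply_ite star, star_one, star_zero, ite_and, mul_ite, mul_one, mul_zero]
      by_cases h1 : s = t <;> by_cases h2 : s' = t' <;>
        simp [h1, h2, Ne.symm (a := s), Ne.symm (a := s')]
    simp only [choi, of_apply, Matrix.sum_apply, submatrix_apply, ampl, hs]
  rw [h]
  exact posSemidef_sum _ fun u _ => posSemidef_sum _ fun v _ => posSemidef_sum _ fun l _ =>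
    hM.submatrix _

lemma sum_choi {w₁ w₂ q : Type*} [Fintype w₁] [Fintype w₂] [Fintype q]
    {N : Matrix α α ℂ →ₗ[ℂ] Matrix (w₁ × w₂ × q × x) (w₁ × w₂ × q × x) ℂ} (hN : IsChannel N)
    (s s' : α) : ∑ k, choi N (s, k) (s', k) = if s = s' then 1 else 0 := by
  have h := hN.2 (Matrix.single s s' 1)
  have h1 : (Matrix.single s s' (1 : ℂ)).trace = if s = s' then 1 else 0 := by
    split_ifs with h
    · subst h; simp
    · exact Matrix.trace_single_eq_of_ne _ _ _ h
  rw [h1] at h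
  rw [← h]
  simp only [choi, of_apply, Matrix.trace, diag_apply, Fintype.sum_prod_type]
  rw [Finset.sum_comm]
  refine Finset.sum_congr rfl fun u _ => ?_
  rw [Finset.sum_comm]
  refine Finset.sum_congr rfl fun v _ => ?_
  rw [Finset.sum_comm]

lemma sum_apply_eq_choi {w₁ w₂ q : Type*} [Fintype w₁] [Fintype w₂] [Fintype q]
    (N : Matrix α α ℂ →ₗ[ℂ] Matrix (w₁ × w₂ × q × x) (w₁ × w₂ × q × x) ℂ) (ω : Matrix α α ℂ)
    (k k' : x) : ∑ u, ∑ v, ∑ l, N ω (u, v, l, k) (u, v, l, k') =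
      ∑ s, ∑ s', ω s s' * choi N (s, k) (s', k') := by
  have h : N ω = ∑ s, ∑ s', ω s s' • N (Matrix.single s s' 1) := by
    conv_lhs => rw [Matrix.matrix_eq_sum_single ω]
    simp only [map_sum, ← map_smul, Matrix.smul_single, smul_eq_mul, mul_one]
  simp only [h, Matrix.sum_apply, Matrix.smul_apply, smul_eq_mul, choi, of_apply, Finset.mul_sum]
  have h3 : ∀ f : w₁ → w₂ → q → α → α → ℂ, ∑ u, ∑ v, ∑ l, ∑ s, ∑ s', f u v l s s' =
      ∑ s, ∑ s', ∑ u, ∑ v, ∑ l, f u v l s s' := by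
    intro f
    have h : ∑ p : w₁ × w₂ × q, ∑ t : α × α, f p.1 p.2.1 p.2.2 t.1 t.2 =
        ∑ t : α × α, ∑ p : w₁ × w₂ × q, f p.1 p.2.1 p.2.2 t.1 t.2 := Finset.sum_comm
    simpa only [Fintype.sum_prod_type] using h
  exact h3 _

/-- Factors `B` of the Choi matrices `Bᴴ B` of channels. -/
def channelFactors (α x : Type*) [Fintype α] [DecidableEq α] [Fintype x] :
    Set (α × x → α × x → ℂ) :=
  {B | ∀ s s', ∑ k, ∑ l, star (B l (s, k)) * B l (s', k) = if s = s' then 1 else 0}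

/-- Using factors `B` makes positivity of `Bᴴ B` automatic, leaving only trace preservation, a
closed condition. Its diagonal case `s = s'` bounds every entry by one. -/
lemma isCompact_channelFactors : IsCompact (channelFactors α x) := by
  refine Metric.isCompact_of_isClosed_isBounded ?_ ?_
  · simp only [channelFactors, Set.ofPred_forall]
    refine isClosed_iInter fun s => isClosed_iInter fun s' => isClosed_eq ?_ continuous_const
    fun_prop
  · refine (Metric.isBounded_closedBall (x := (0 : α × x → α × x → ℂ)) (r := 1)).subset ?_
    intro B hB
    rw [mem_closedBall_zero_iff, pi_norm_le_iff_of_nonneg zero_le_one]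
    intro l
    rw [pi_norm_le_iff_of_nonneg zero_le_one]
    rintro ⟨s, k⟩
    have h := hB s s
    simp only [if_true, RCLike.star_def, mul_comm ((starRingEnd ℂ) _), Complex.mul_conj,
      Complex.normSq_eq_norm_sq, ← Complex.ofReal_sum] at h
    have h' : ∑ k, ∑ l, ‖B l (s, k)‖ ^ 2 = 1 := by exact_mod_cast h
    have h1 : ‖B l (s, k)‖ ^ 2 ≤ ∑ l, ‖B l (s, k)‖ ^ 2 :=
      Finset.single_le_sum (f := fun l => ‖B l (s, k)‖ ^ 2) (fun _ _ => by positivity)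
        (Finset.mem_univ l)
    have h2 : ∑ l, ‖B l (s, k)‖ ^ 2 ≤ ∑ k, ∑ l, ‖B l (s, k)‖ ^ 2 :=
      Finset.single_le_sum (f := fun k => ∑ l, ‖B l (s, k)‖ ^ 2) (fun _ _ => by positivity)
        (Finset.mem_univ k)
    nlinarith [norm_nonneg (B l (s, k))]

end Choi

/-! ### Optimal channels, trivial registers and the choice of a protocol. -/

section Main

variable {r a b x : Type*} [Fintype r] [Fintype a] [Fintype b] [Fintype x]
  [DecidableEq r] [DecidableEq a] [DecidableEq b] [DecidableEq x]

/-- The expected distortion of the channel with Choi matrix `C`. -/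
noncomputable def Setup.choiDistortion (s : Setup r a b x)
    (C : Matrix ((a × b) × x) ((a × b) × x) ℂ) : ℝ :=
  (s.Δ * of fun i i' : r × x => ∑ y, ∑ y', s.Ψ (i.1, y) (i'.1, y') * C (y, i.2) (y', i'.2)).trace.re

lemma Setup.choiDistortion_choi (s : Setup r a b x) {w₁ w₂ q : Type*} [Fintype w₁] [Fintype w₂]
    [Fintype q] (N : Matrix (a × b) (a × b) ℂ →ₗ[ℂ] Matrix (w₁ × w₂ × q × x) (w₁ × w₂ × q × x) ℂ) :
    s.choiDistortion (choi N) = (s.Δ * of fun i i' : r × x => ∑ u, ∑ v, ∑ l,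
      ampl r N s.Ψ (i.1, u, v, l, i.2) (i'.1, u, v, l, i'.2)).trace.re := by
  simp only [Setup.choiDistortion, ampl, of_apply, sum_apply_eq_choi]

lemma Setup.continuous_choiDistortion (s : Setup r a b x) :
    Continuous fun B : (a × b) × x → (a × b) × x → ℂ =>
      s.choiDistortion (of fun i i' => ∑ l, star (B l i) * B l i') := by
  simp only [Setup.choiDistortion, Matrix.trace, diag_apply, Matrix.mul_apply, of_apply]
  fun_prop

/-- The infimum of the distortions of channels is attained. -/
lemma Setup.exists_optimal_channel (s : Setup r a b x) {D : ℝ}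
    (h : ∀ ε > 0, ∃ (w₁ w₂ : Type) (q : Type*) (_ : Fintype w₁) (_ : Fintype w₂) (_ : Fintype q)
      (N : Matrix (a × b) (a × b) ℂ →ₗ[ℂ] Matrix (w₁ × w₂ × q × x) (w₁ × w₂ × q × x) ℂ),
      IsChannel N ∧ s.choiDistortion (choi N) ≤ D + ε) :
    ∃ C : Matrix ((a × b) × x) ((a × b) × x) ℂ, C.PosSemidef ∧
      (∀ y y', ∑ k, C (y, k) (y', k) = if y = y' then 1 else 0) ∧ s.choiDistortion C ≤ D := by
  -- The registers of `N` may grow as `ε` shrinks, but after discarding them all the Choi matrices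
  -- lie in one fixed finite-dimensional space.
  have key : ∀ ε > 0, ∃ B ∈ channelFactors (a × b) x,
      s.choiDistortion (of fun i i' => ∑ l, star (B l i) * B l i') ≤ D + ε := by
    intro ε hε
    obtain ⟨w₁, w₂, q, _, _, _, N, hN, hD⟩ := h ε hε
    obtain ⟨B, hB⟩ := exists_eq_conjTranspose_mul (posSemidef_choi hN)
    have hB' : choi N = of fun i i' => ∑ l, star (B l i) * B l i' := by
      rw [hB]; ext; simp [Matrix.mul_apply]
    refine ⟨B, fun y y' => ?_, hB' ▸ hD⟩
    rw [← sum_choi hN y y', hB']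
    rfl
  obtain ⟨B₀, hB₀, -⟩ := key 1 one_pos
  obtain ⟨B, hB, hmin⟩ := isCompact_channelFactors.exists_isMinOn ⟨B₀, hB₀⟩
    s.continuous_choiDistortion.continuousOn
  refine ⟨of fun i i' => ∑ l, star (B l i) * B l i', ?_, fun y y' => hB y y', ?_⟩
  · have : (of fun i i' => ∑ l, star (B l i) * B l i') = (of B)ᴴ * of B := by
      ext; simp [Matrix.mul_apply]
    rw [this]
    exact posSemidef_conjTranspose_mul_self _
  · refine le_of_forall_pos_le_add fun ε hε => ?_
    obtain ⟨B', hB', hD⟩ := key ε hε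
    exact (hmin hB').trans hD

section Trivial

variable {u q : Type*} [Unique u] [Fintype u] [DecidableEq u] [Unique q] [Fintype q]
  [DecidableEq q] {ρ : Matrix r r ℂ}

lemma mutualInfo_trivial (hρ : IsDensity ρ) :
    mutualInfo (of fun i i' : r × q => ρ i.1 i'.1) = 0 := by
  have h1 : trRight (of fun i i' : r × q => ρ i.1 i'.1) = ρ := by
    ext; simp [trRight]
  have h2 : entropy (of fun i i' : r × q => ρ i.1 i'.1) = entropy ρ :=
    entropy_submatrix ρ hρ.1.1 (Equiv.prodUnique r q)
  have h3 : entropy (trLeft (of fun i i' : r × q => ρ i.1 i'.1)) = 0 := by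
    have hp : (of fun i i' : r × q => ρ i.1 i'.1).PosSemidef := hρ.1.submatrix Prod.fst
    rw [entropy_unique (posSemidef_trLeft hp).1, trace_trLeft, ← trace_trRight, h1, hρ.2]
    simp
  rw [mutualInfo, h1, h2, h3]
  simp

lemma condMutualInfo_trivial (hρ : IsDensity ρ) :
    condMutualInfo (of fun i i' : u × r × q => ρ i.2.1 i'.2.1) = 0 := by
  have h1 : trLeft (of fun i i' : u × r × q => ρ i.2.1 i'.2.1) =
      of fun i i' : r × q => ρ i.1 i'.1 := by
    ext; simp [trLeft]
  have h2 : entropy (of fun i i' : u × r × q => ρ i.2.1 i'.2.1) = entropy ρ :=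
    entropy_submatrix ρ hρ.1.1 ((Equiv.uniqueProd (r × q) u).trans (Equiv.prodUnique r q))
  have h3 : entropy (trMid (of fun i i' : u × r × q => ρ i.2.1 i'.2.1)) = 0 := by
    have h : trMid (of fun i i' : u × r × q => ρ i.2.1 i'.2.1) = 1 := by
      ext i i'
      rw [Subsingleton.elim i i', Matrix.one_apply_eq]
      exact hρ.2
    have : Unique (u × q) := Unique.mk' _
    rw [h, entropy_unique Matrix.isHermitian_one]
    simp
  have h4 := mutualInfo_trivial (q := q) hρ
  rw [mutualInfo] at h4
  have h5 : trRight (of fun i i' : r × q => ρ i.1 i'.1) = ρ := by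
    ext; simp [trRight]
  rw [h5] at h4
  rw [condMutualInfo, h1, h2, h3]
  linarith

end Trivial

/-- With trivial auxiliary registers all information quantities vanish, and the reconstruction is an
unrestricted output of the test channel, so only the distortion condition remains. -/
lemma Setup.outerBound_choiMap (s : Setup r a b x) {C : Matrix ((a × b) × x) ((a × b) × x) ℂ}
    (hC : C.PosSemidef) (hC' : ∀ y y', ∑ k, C (y, k) (y', k) = if y = y' then 1 else 0)
    {R₁ R₂ D : ℝ} (hR₁ : 0 ≤ R₁) (hR₂ : 0 ≤ R₂) (hD : s.choiDistortion C ≤ D) :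
    s.OuterBound (choiMap C) R₁ R₂ D := by
  have hσ : ∀ w w' (u u' v v' l l' : Fin 1),
      ∑ k, ampl r (choiMap C) s.Ψ (w, u, v, l, k) (w', u', v', l', k) = trRight s.Ψ w w' := by
    intro w w' u u' v v' l l'
    simp only [ampl, choiMap, LinearMap.coe_mk, AddHom.coe_mk, of_apply, trRight]
    rw [Finset.sum_comm]
    refine Finset.sum_congr rfl fun y _ => ?_
    rw [Finset.sum_comm]
    simp only [← Finset.mul_sum, hC']
    simp
  have hρ := s.isDensity_reference
  have : Unique (Fin 1 × Fin 1) := Unique.mk' _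
  refine ⟨isChannel_choiMap hC hC', ?_, ?_, ?_, ?_, ?_⟩
  · simp only [hσ]
    have h : trLeft (of fun i i' : (Fin 1 × Fin 1) × r × Fin 1 => trRight s.Ψ i.2.1 i'.2.1) =
        of fun i i' : r × Fin 1 => trRight s.Ψ i.1 i'.1 := by
      ext; simp [trLeft]
    rw [h, mutualInfo_trivial hρ]
  · simp only [hσ]
    rwa [condMutualInfo_trivial hρ]
  · simp only [hσ]
    rwa [condMutualInfo_trivial hρ]
  · simp only [hσ]
    rw [condMutualInfo_trivial hρ]
    exact add_nonneg hR₁ hR₂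
  · refine le_of_eq_of_le ?_ hD
    simp [Setup.choiDistortion, ampl, choiMap]

lemma Setup.Achievable.exists_protocol {s : Setup r a b x} {R₁ R₂ D : ℝ}
    (h : s.Achievable R₁ R₂ D) {ε : ℝ} (hε : 0 < ε) :
    ∃ (m Θ₁ Θ₂ : ℕ) (P : Protocol a b x (m + 1) Θ₁ Θ₂), Θ₁ ≠ 0 ∧ Θ₂ ≠ 0 ∧
      1 / ((m + 1 : ℕ) : ℝ) * Real.logb 2 Θ₁ ≤ R₁ + ε ∧
      1 / ((m + 1 : ℕ) : ℝ) * Real.logb 2 Θ₂ ≤ R₂ + ε ∧ s.distortion P ≤ D + ε := by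
  obtain ⟨n, ⟨Θ₁, Θ₂, P, h₁, h₂, h₃⟩, hn⟩ := ((h ε hε).and (Filter.eventually_ge_atTop 1)).exists
  obtain ⟨m, rfl⟩ : ∃ m, n = m + 1 := ⟨n - 1, by omega⟩
  -- A unit vector exists only on a nonempty index type. There the identity is nonzero, so a POVM
  -- cannot have an empty set of outcomes.
  have hne : Nonempty (r × a × b) := by
    by_contra hne
    rw [not_nonempty_iff] at hne
    simpa using s.ψ_norm
  obtain ⟨-, y, z⟩ := hne.some
  refine ⟨m, Θ₁, Θ₂, P, ?_, ?_, h₁, h₂, h₃⟩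
  · rintro rfl
    have := congrFun (congrFun P.povmA.2 fun _ => y) fun _ => y
    simp at this
  · rintro rfl
    have := congrFun (congrFun P.povmB.2 fun _ => z) fun _ => z
    simp at this

end Main

end QCRD

theorem mainTheorem4 {r a b x : Type*} [Fintype r] [Fintype a] [Fintype b] [Fintype x]
    [DecidableEq r] [DecidableEq a] [DecidableEq b] [DecidableEq x]
    (s : QCRD.Setup r a b x) (R₁ R₂ D : ℝ) (h : s.Achievable R₁ R₂ D) :
    (∃ (w₁ w₂ q : ℕ) (N : Matrix (a × b) (a × b) ℂ →ₗ[ℂ]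
        Matrix (Fin w₁ × Fin w₂ × Fin q × x) (Fin w₁ × Fin w₂ × Fin q × x) ℂ),
      s.OuterBound N R₁ R₂ D) ∧
    ∀ ε > 0, ∃ (m w₁ w₂ : ℕ) (N : Matrix (a × b) (a × b) ℂ →ₗ[ℂ]
        Matrix (Fin w₁ × Fin w₂ × QCRD.Fock r (m + 1) × x)
          (Fin w₁ × Fin w₂ × QCRD.Fock r (m + 1) × x) ℂ),
      QCRD.IsDistributed N ∧ s.OuterBound N (R₁ + ε) (R₂ + ε) (D + ε) := by
  constructor
  -- Logarithms of natural numbers are nonnegative, including the default `Real.log 0 = 0`, so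
  -- achievable rates are nonnegative.
  · have hlog : ∀ m Θ : ℕ, 0 ≤ 1 / ((m + 1 : ℕ) : ℝ) * Real.logb 2 Θ := fun m Θ =>
      mul_nonneg (by positivity) (div_nonneg (Real.log_natCast_nonneg Θ) (Real.log_nonneg (by norm_num)))
    have hR₁ : 0 ≤ R₁ := le_of_forall_pos_le_add fun ε hε => by
      obtain ⟨m, Θ₁, Θ₂, P, -, -, h₁, -, -⟩ := h.exists_protocol hε
      exact (hlog m Θ₁).trans h₁
    have hR₂ : 0 ≤ R₂ := le_of_forall_pos_le_add fun ε hε => by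
      obtain ⟨m, Θ₁, Θ₂, P, -, -, -, h₂, -⟩ := h.exists_protocol hε
      exact (hlog m Θ₂).trans h₂
    -- The test channels from (b) serve only to show that channels come within every `ε` of
    -- distortion `D`. Compactness then removes the `ε`.
    obtain ⟨C, hC, hC', hD⟩ := s.exists_optimal_channel (D := D) fun ε hε => by
      obtain ⟨m, Θ₁, Θ₂, P, -, -, -, -, h₃⟩ := h.exists_protocol hε
      refine ⟨_, _, _, _, _, _, _, s.isChannel_testChannel P, ?_⟩
      rw [s.choiDistortion_choi, s.distortion_testChannel]
      exact h₃
    exact ⟨1, 1, 1, QCRD.choiMap C, s.outerBound_choiMap hC hC' hR₁ hR₂ hD⟩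
  · intro ε hε
    obtain ⟨m, Θ₁, Θ₂, P, hΘ₁, hΘ₂, h₁, h₂, h₃⟩ := h.exists_protocol hε
    exact ⟨m, Θ₁, Θ₂, s.testChannel P, s.isDistributed_testChannel P,
      s.outerBound_testChannel P h₁ h₂ hΘ₁ hΘ₂ h₃⟩
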